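/- Let $\mathcal A$ be a hereditary abelian category (i.e. $\operatorname{Ext}^i_{\mathcal A}(X,Y)=0$ for all objects $X,Y$ and all $i\ge 2$) with enough projectives, and write $H_k=H^{-k}\colon D^b\mathcal A\to\mathcal A$. Subcategories are full and closed under isomorphisms. A subcategory of an abelian category is narrow if it is closed under extensions and cokernels. A sequence $(\mathcal N(k))_{k\in\mathbb Z}$ of narrow subcategories is a narrow sequence if for all $k$: (1) $\mathcal N(k)\subseteq\mathcal N(k+1)$; and (2) if $A\to B\to C\to D\to E$ is exact with $A\in\mathcal N(k+1)$, $B,D\in\mathcal N(k)$ and $E\in\mathcal N(k-1)$, then $C\in\mathcal N(k)$. A sequence $(\mathcal C(k))_{k\in\mathbb Z}$ of subcategories of $\mathcal A$ is a co-narrow sequence if $(\mathcal C(-k)^{\mathrm{op}})_{k\in\mathbb Z}$ is a narrow sequence in $\mathcal A^{\mathrm{op}}$; it is reflective if each embedding $\mathcal C(k)\to\mathcal A$ has a left adjoint. For a subcategory $\mathcal V$ of $D^b\mathcal A$ put $\mu(\mathcal V)=(H_k\mathcal V)_{k\in\mathbb Z}$, where $H_k\mathcal V$ is the essential image of $\mathcal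 V$ under $H_k$; for a sequence $\mathcal C=(\mathcal C(k))_{k\in\mathbb Z}$ of subcategories of $\mathcal A$ put $\theta(\mathcal C)=\{X\in D^b\mathcal A \mid H_k(X)\in\mathcal C(k)\text{ for all }k\in\mathbb Z\}$. Then there are mutually inverse bijections $$\{t\text{-structures on } D^b\mathcal A\}\;\longleftrightarrow\;\{\text{reflective co-narrow sequences in }\mathcal A\},$$ which send a $t$-structure $(D^{\le 0},D^{\ge 0})$ to the sequence $\mu(D^{\ge 0})$ of its coaisle $D^{\ge 0}$, and a reflective co-narrow sequence $\mathcal C$ to the unique $t$-structure whose coaisle $D^{\ge 0}$ is $\theta(\mathcal C)$. -/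

import Mathlib

open CategoryTheory CategoryTheory.Limits CategoryTheory.Triangulated

universe w v u

/-- An abelian category is hereditary if it has global dimension at most one, i.e. if
`Ext^i(X, Y) = 0` for all objects `X`, `Y` and all `i ≥ 2`. -/
def IsHereditary (A : Type u) [Category.{v} A] [Abelian A] : Prop :=
  ∀ X : A, HasProjectiveDimensionLE X 1

/-- A narrow subcategory of an abelian category: a full subcategory which is closed under
extensions and cokernels. Closure under isomorphisms is implied, since every object isomorphic to
`X` is a cokernel of the zero endomorphism of `X`. -/
structure IsNarrow {A : Type u} [Category.{v} A] [Abelian A] (P : ObjectProperty A) : Prop where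
  extensions : P.IsClosedUnderExtensions
  cokernels : P.IsClosedUnderCokernels

/-- A narrow sequence in an abelian category. -/
structure IsNarrowSequence {A : Type u} [Category.{v} A] [Abelian A]
    (N : ℤ → ObjectProperty A) : Prop where
  narrow (k : ℤ) : IsNarrow (N k)
  le_succ (k : ℤ) : N k ≤ N (k + 1)
  of_exact (k : ℤ) {X₁ X₂ X₃ X₄ X₅ : A}
    (f₁ : X₁ ⟶ X₂) (f₂ : X₂ ⟶ X₃) (f₃ : X₃ ⟶ X₄) (f₄ : X₄ ⟶ X₅)
    (w₂ : f₁ ≫ f₂ = 0) (w₃ : f₂ ≫ f₃ = 0) (w₄ : f₃ ≫ f₄ = 0)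
    (exact₂ : (ShortComplex.mk f₁ f₂ w₂).Exact)
    (exact₃ : (ShortComplex.mk f₂ f₃ w₃).Exact)
    (exact₄ : (ShortComplex.mk f₃ f₄ w₄).Exact)
    (h₁ : N (k + 1) X₁) (h₂ : N k X₂) (h₄ : N k X₄) (h₅ : N (k - 1) X₅) : N k X₃

/-- A sequence `C` of full subcategories of `A` is a co-narrow sequence if the sequence
`k ↦ C (-k)ᵒᵖ` is a narrow sequence in the opposite category of `A`. -/
def IsCoNarrowSequence {A : Type u} [Category.{v} A] [Abelian A]
    (C : ℤ → ObjectProperty A) : Prop :=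
  IsNarrowSequence fun k : ℤ ↦ (C (-k)).op

/-- A reflective co-narrow sequence: each embedding `C k ⥤ A` has a left adjoint. -/
structure IsReflectiveCoNarrowSequence {A : Type u} [Category.{v} A] [Abelian A]
    (C : ℤ → ObjectProperty A) : Prop where
  coNarrow : IsCoNarrowSequence C
  reflective (k : ℤ) : (C k).ι.IsRightAdjoint

/-- The homology functor `H_k : D^b A ⥤ A` in homological grading, `H_k = H^{-k}`. -/
noncomputable def boundedHomology (A : Type u) [Category.{v} A] [Abelian A]
    [HasDerivedCategory.{w} A] (k : ℤ) : DerivedCategory.Bounded A ⥤ A :=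
  DerivedCategory.Bounded.ι ⋙ DerivedCategory.homologyFunctor A (-k)

/-- The sequence `k ↦ H_k V` of full replete subcategories of `A` attached to a full subcategory
`V` of `D^b A`. -/
noncomputable def mu {A : Type u} [Category.{v} A] [Abelian A] [HasDerivedCategory.{w} A]
    (V : ObjectProperty (DerivedCategory.Bounded A)) : ℤ → ObjectProperty A :=
  fun k ↦ V.map (boundedHomology A k)

/-- The full subcategory of `D^b A` of the objects `X` with `H_k X ∈ C k` for all `k`. -/
noncomputable def theta {A : Type u} [Category.{v} A] [Abelian A] [HasDerivedCategory.{w} A]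
    (C : ℤ → ObjectProperty A) : ObjectProperty (DerivedCategory.Bounded A) :=
  fun X ↦ ∀ k : ℤ, C k ((boundedHomology A k).obj X)

/-! Write stalk for an object of `A` placed in a single degree, and put `F n = C (-n)`. Over a
hereditary category every bounded complex is a finite direct sum of stalks (`biprod_induction`,
`exists_retract_single`), so a coaisle `V`, being closed under sums and summands, is determined by
its stalks. In cohomological degree `n` these form both `mu V (-n)` and the preimage of `V` under
`single A n`.

From a coaisle to a sequence: cones and fibres of maps between stalks give the closure conditions,
and the `n`-th cohomology of a reflection of a stalk in degree `n` is a reflection in `A`.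

From a sequence to a coaisle: the five-term condition is the one needed for the long exact sequence
to make `homologyIn F` extension-closed, and monotonicity makes it stable under the shift by `-1`.
By Wakamatsu's lemma (`leftOrthogonal_of_bijective`) it then suffices to reflect each stalk. Let `B`
sit in degree `n`, and let `N` be the fibre of its reflection `B ⟶ L` in `F n`. The cohomology of
`N` is the kernel in degree `n` and the cokernel in degree `n + 1`, and `N` can map nontrivially
only to objects of `F (n - 1)` in degree `n - 1`. The cokernel part is therefore left orthogonal to
`homologyIn F`. The kernel part is reflected by applying the reflection of `F (n - 1)` to a
projective resolution of length one (`hasReflection_single_of_hom_eq_zero`). -/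

section

open CategoryTheory.Pretriangulated ZeroObject

/-! ### Coaisles, Wakamatsu's lemma and t-structures in a triangulated category. -/

namespace CategoryTheory.Triangulated.TStructure

variable {D : Type*} [Category* D] [Preadditive D] [HasZeroObject D] [HasShift D ℤ]
  [∀ n : ℤ, (shiftFunctor D n).Additive] [Pretriangulated D]

/-- A t-structure is determined by its coaisle. -/
theorem ext_of_ge_zero [IsTriangulated D] {t t' : TStructure D} (h : t.ge 0 = t'.ge 0) :
    t = t' := by
  have hge : t.ge = t'.ge := by
    ext n X
    rw [← t.shift_ge n 0 n (add_zero n), ← t'.shift_ge n 0 n (add_zero n), h]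
  have hle : t.le = t'.le := by
    ext n X
    rw [le_iff_isLE, le_iff_isLE, t.isLE_iff_orthogonal n (n + 1) rfl,
      t'.isLE_iff_orthogonal n (n + 1) rfl]
    simp only [← ge_iff_isGE, hge]
  cases t
  cases t'
  simp_all

end CategoryTheory.Triangulated.TStructure

/-- A morphism from the first object of a distinguished triangle factors through the first
morphism if its composition with the connecting morphism vanishes. -/
theorem CategoryTheory.Pretriangulated.exists_eq_mor₁_comp_of_distTriang {D : Type*} [Category* D]
    [Preadditive D] [HasZeroObject D] [HasShift D ℤ] [∀ n : ℤ, (shiftFunctor D n).Additive]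
    [Pretriangulated D] {N X R Y : D} {i : N ⟶ X} {η : X ⟶ R} {δ : R ⟶ N⟦(1 : ℤ)⟧}
    (hT : Triangle.mk i η δ ∈ distTriang D) (f : N ⟶ Y) (hf : δ ≫ f⟦(1 : ℤ)⟧' = 0) :
    ∃ g : X ⟶ Y, f = i ≫ g := by
  obtain ⟨g, hg⟩ : ∃ g : X⟦(1 : ℤ)⟧ ⟶ Y⟦(1 : ℤ)⟧, f⟦(1 : ℤ)⟧' = (-i⟦(1 : ℤ)⟧') ≫ g :=
    Triangle.yoneda_exact₂ _ (rot_of_distTriang _ (rot_of_distTriang _ hT)) (f⟦(1 : ℤ)⟧') hf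
  obtain ⟨g', rfl⟩ := (shiftFunctor D (1 : ℤ)).map_surjective g
  exact ⟨-g', (shiftFunctor D (1 : ℤ)).map_injective (by simp [hg])⟩

namespace CategoryTheory.ObjectProperty

variable {D : Type*} [Category* D] [Preadditive D] [HasZeroObject D] [HasShift D ℤ]
  [∀ n : ℤ, (shiftFunctor D n).Additive] [Pretriangulated D]

/-- Wakamatsu's lemma: the fibre of a reflection onto an extension-closed subcategory is left
orthogonal to that subcategory. -/
theorem leftOrthogonal_of_bijective (V : ObjectProperty D) [V.IsTriangulatedClosed₂]
    {N X R : D} {i : N ⟶ X} {η : X ⟶ R} {δ : R ⟶ N⟦(1 : ℤ)⟧}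
    (hT : Triangle.mk i η δ ∈ distTriang D) (hR : V R)
    (hη : ∀ Y, V Y → Function.Bijective (fun g : R ⟶ Y ↦ η ≫ g)) : V.leftOrthogonal N := by
  intro Y f hY
  -- `E` is the extension of `R` by `Y` classified by `δ ≫ f⟦1⟧'`. It lies in `V` and `η` lifts to
  -- it, so the universal property of `η` splits it. Hence `f` extends along `i` to `X`, and this
  -- extension factors through `η`, which `i` kills.
  obtain ⟨E, hE, a, b, hE'⟩ := V.distinguished_cocone_triangle₂ (δ ≫ f⟦(1 : ℤ)⟧') hY hR
  have hηδ : η ≫ δ = 0 := comp_distTriang_mor_zero₂₃ _ hT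
  obtain ⟨s, hs⟩ := Triangle.coyoneda_exact₃ _ hE' η (by
    change η ≫ δ ≫ f⟦(1 : ℤ)⟧' = 0
    rw [reassoc_of% hηδ, zero_comp])
  obtain ⟨r, hr⟩ := (hη E hE).2 s
  have hrb : r ≫ b = 𝟙 R := (hη R hR).1 (by
    change η ≫ r ≫ b = η ≫ 𝟙 R
    rw [Category.comp_id, ← Category.assoc]
    exact (congrArg (· ≫ b) hr).trans hs.symm)
  have hδf : δ ≫ f⟦(1 : ℤ)⟧' = 0 := by
    have h : b ≫ δ ≫ f⟦(1 : ℤ)⟧' = 0 := comp_distTriang_mor_zero₂₃ _ hE'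
    rw [← Category.id_comp (δ ≫ _), ← hrb, Category.assoc, h, comp_zero]
  obtain ⟨g, hfg⟩ := exists_eq_mor₁_comp_of_distTriang hT f hδf
  obtain ⟨k, hk⟩ := (hη Y hY).2 g
  have hiη : i ≫ η = 0 := comp_distTriang_mor_zero₁₂ _ hT
  rw [hfg, ← hk, reassoc_of% hiη, zero_comp]

/-- The t-structure whose coaisle is a given extension-closed and coshift-stable subcategory `V`
such that every object is an extension of an object of `V` by an object left orthogonal to `V`. -/
def tStructureOfCoaisle (V : ObjectProperty D) [V.IsClosedUnderIsomorphisms]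
    (hV : ∀ X, V X → V (X⟦(-1 : ℤ)⟧))
    (h : ∀ X, extensionProduct V.leftOrthogonal V X) : TStructure D where
  -- With `ge 0` equal to `V`, it is `le (-1)` that must be `V.leftOrthogonal`; hence the shift by
  -- `n + 1`.
  le n X := V.leftOrthogonal (X⟦n + 1⟧)
  ge n X := V (X⟦n⟧)
  le_isClosedUnderIsomorphisms n :=
    ⟨fun e hX ↦ V.leftOrthogonal.prop_of_iso ((shiftFunctor D (n + 1)).mapIso e) hX⟩
  ge_isClosedUnderIsomorphisms n :=
    ⟨fun e hX ↦ V.prop_of_iso ((shiftFunctor D n).mapIso e) hX⟩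
  le_shift n a n' h X hX :=
    V.leftOrthogonal.prop_of_iso ((shiftFunctorAdd' D a (n' + 1) (n + 1) (by lia)).app X) hX
  ge_shift n a n' h X hX :=
    V.prop_of_iso ((shiftFunctorAdd' D a n' n (by lia)).app X) hX
  zero' X Y f hX hY := (shiftFunctor D (1 : ℤ)).map_injective (by
    rw [Functor.map_zero]
    exact hX _ hY)
  le_zero_le X hX Y f hY := by
    let e : X⟦(1 + 1 : ℤ)⟧ ≅ (X⟦(0 + 1 : ℤ)⟧)⟦(1 : ℤ)⟧ :=
      (shiftFunctorAdd' D (0 + 1 : ℤ) 1 (1 + 1) (by lia)).app X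
    let e' : (Y⟦(-1 : ℤ)⟧)⟦(1 : ℤ)⟧ ≅ Y := (shiftFunctorCompIsoId D (-1 : ℤ) 1 (by lia)).app Y
    obtain ⟨g, hg⟩ := (shiftFunctor D (1 : ℤ)).map_surjective (e.inv ≫ f ≫ e'.inv)
    have hg0 : g = 0 := hX g (hV _ hY)
    rw [hg0, Functor.map_zero] at hg
    rw [← cancel_epi e.inv, ← cancel_mono e'.inv, comp_zero, zero_comp, Category.assoc, ← hg]
  ge_one_le X hX := V.prop_of_iso
    ((shiftFunctorAdd' D 1 (-1) 0 (by lia)).symm.app X) (hV _ hX)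
  exists_triangle_zero_one X := by
    -- The hypothesis provides triangles for the pair `(-1, 0)`; the pair `(0, 1)` comes from
    -- decomposing `X⟦1⟧` and shifting back.
    obtain ⟨U, W, f, g, k, hT, hU, hW⟩ := h (X⟦(1 : ℤ)⟧)
    have hX : extensionProduct (fun Y ↦ V.leftOrthogonal (Y⟦(0 + 1 : ℤ)⟧))
        (fun Y ↦ V (Y⟦(1 : ℤ)⟧)) ((X⟦(1 : ℤ)⟧)⟦(-1 : ℤ)⟧) :=
      ⟨U⟦(-1 : ℤ)⟧, W⟦(-1 : ℤ)⟧, _, _, _, Triangle.shift_distinguished _ hT (-1),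
        V.leftOrthogonal.prop_of_iso
          ((shiftFunctorCompIsoId D (-1 : ℤ) (0 + 1) (by lia)).symm.app U) hU,
        V.prop_of_iso ((shiftFunctorCompIsoId D (-1 : ℤ) 1 (by lia)).symm.app W) hW⟩
    obtain ⟨U', W', f', g', k', hT', hU', hW'⟩ :=
      prop_of_iso _ ((shiftFunctorCompIsoId D (1 : ℤ) (-1) (by lia)).app X) hX
    exact ⟨U', W', hU', hW', f', g', k', hT'⟩

theorem tStructureOfCoaisle_ge_zero (V : ObjectProperty D) [V.IsClosedUnderIsomorphisms]
    (hV : ∀ X, V X → V (X⟦(-1 : ℤ)⟧))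
    (h : ∀ X, extensionProduct V.leftOrthogonal V X) :
    (V.tStructureOfCoaisle hV h).ge 0 = V := by
  ext X
  exact V.prop_iff_of_iso ((shiftFunctorZero D ℤ).app X)

/-- `V.leftOrthogonal * V` absorbs extensions by `V` on the right. -/
theorem extensionProduct_leftOrthogonal_of_distTriang [IsTriangulated D]
    (V : ObjectProperty D) [V.IsClosedUnderIsomorphisms] [V.IsTriangulatedClosed₂]
    (T : Triangle D) (hT : T ∈ distTriang D)
    (h₁ : extensionProduct V.leftOrthogonal V T.obj₁) (h₃ : V T.obj₃) :
    extensionProduct V.leftOrthogonal V T.obj₂ := by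
  have h : extensionProduct (extensionProduct V.leftOrthogonal V) V T.obj₂ :=
    ⟨_, _, T.mor₁, T.mor₂, T.mor₃, hT, h₁, h₃⟩
  rw [extensionProduct_assoc] at h
  exact monotone_extensionProduct_right _
    (extensionProduct_le_of_isTriangulatedClosed₂ le_rfl le_rfl) _ h

end CategoryTheory.ObjectProperty

/-! ### Stalks, cohomology and dévissage in the bounded derived category. -/

namespace DerivedCategory.Bounded

variable (A : Type u) [Category.{v} A] [Abelian A] [HasDerivedCategory.{w} A]

/-- The single functors `A ⥤ D^b A`. -/
noncomputable def singleFunctors : SingleFunctors A (Bounded A) ℤ :=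
  SingleFunctors.lift (DerivedCategory.singleFunctors A) Bounded.ι
    (fun n ↦ TStructure.t.bounded.lift (DerivedCategory.singleFunctor A n)
      (fun _ ↦ ⟨⟨n, inferInstance⟩, ⟨n, inferInstance⟩⟩))
    (fun _ ↦ Iso.refl _)

/-- The functor `A ⥤ D^b A` which sends `X` to `X` placed in cohomological degree `n`. -/
noncomputable def single (n : ℤ) : A ⥤ Bounded A := (singleFunctors A).functor n

/-- The cohomology functor `D^b A ⥤ A` in cohomological degree `n`. -/
noncomputable def homology (n : ℤ) : Bounded A ⥤ A :=
  Bounded.ι ⋙ DerivedCategory.homologyFunctor A n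

instance (n : ℤ) : (single A n).Full :=
  have : (single A n ⋙ Bounded.ι).Full :=
    inferInstanceAs (DerivedCategory.singleFunctor A n).Full
  Functor.Full.of_comp_faithful (single A n) Bounded.ι

instance (n : ℤ) : (single A n).Faithful :=
  have : (single A n ⋙ Bounded.ι).Faithful :=
    inferInstanceAs (DerivedCategory.singleFunctor A n).Faithful
  Functor.Faithful.of_comp (single A n) Bounded.ι

instance (n : ℤ) : (single A n).Additive :=
  have : (single A n ⋙ Bounded.ι).Additive :=
    inferInstanceAs (DerivedCategory.singleFunctor A n).Additive
  Functor.additive_of_comp_faithful (single A n) Bounded.ι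

instance (n : ℤ) : (homology A n).IsHomological :=
  inferInstanceAs (Bounded.ι ⋙ DerivedCategory.homologyFunctor A n).IsHomological

noncomputable instance : (homology A 0).ShiftSequence ℤ :=
  inferInstanceAs ((Bounded.ι ⋙ DerivedCategory.homologyFunctor A 0).ShiftSequence ℤ)

/-- The object `X` placed in degree `n` has cohomology `X` in degree `n`. -/
noncomputable def singleCompHomology (n : ℤ) : single A n ⋙ homology A n ≅ 𝟭 A :=
  DerivedCategory.singleFunctorCompHomologyFunctorIso A n

variable {A}

/-- The shift of an object placed in a single degree. -/
noncomputable def singleShift (X : A) (a n n' : ℤ) (h : a + n' = n) :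
    ((single A n).obj X)⟦a⟧ ≅ (single A n').obj X :=
  ((singleFunctors A).shiftIso a n' n h).app X

theorem isZero_homology_single (X : A) {m n : ℤ} (h : m ≠ n) :
    IsZero ((homology A m).obj ((single A n).obj X)) := by
  rcases h.lt_or_gt with h | h
  · exact DerivedCategory.isZero_of_isGE ((DerivedCategory.singleFunctor A n).obj X) n m h
  · exact DerivedCategory.isZero_of_isLE ((DerivedCategory.singleFunctor A n).obj X) n m h

/-- Cohomology of a shift. -/
noncomputable def homologyShift (X : Bounded A) (a n n' : ℤ) (h : a + n = n') :
    (homology A n).obj (X⟦a⟧) ≅ (homology A n').obj X :=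
  ((homology A 0).shiftIso a n n' h).app X

theorem nonempty_iso_single (X : Bounded A) (n : ℤ)
    (h : ∀ m, m ≠ n → IsZero ((homology A m).obj X)) :
    Nonempty (X ≅ (single A n).obj ((homology A n).obj X)) := by
  have : X.obj.IsGE n := (DerivedCategory.isGE_iff _ _).2 fun m hm ↦ h m hm.ne
  have : X.obj.IsLE n := (DerivedCategory.isLE_iff _ _).2 fun m hm ↦ h m hm.ne'
  obtain ⟨Y, ⟨e⟩⟩ := DerivedCategory.exists_iso_singleFunctor_obj_of_isGE_of_isLE X.obj n
  let e' : X ≅ (single A n).obj Y := ObjectProperty.isoMk _ e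
  exact ⟨e' ≪≫ (single A n).mapIso (((homology A n).mapIso e' ≪≫
    (singleCompHomology A n).app Y).symm)⟩

theorem exists_distTriang_of_ι {X Y Z : Bounded A} (f : X ⟶ Y) (g : Y ⟶ Z)
    (d : Bounded.ι.obj Z ⟶ (Bounded.ι.obj X)⟦(1 : ℤ)⟧)
    (h : Triangle.mk (Bounded.ι.map f) (Bounded.ι.map g) d ∈ distTriang (DerivedCategory A)) :
    ∃ δ : Z ⟶ X⟦(1 : ℤ)⟧, Triangle.mk f g δ ∈ distTriang (Bounded A) := by
  obtain ⟨δ, hδ⟩ := (Bounded.ι (C := A)).map_surjective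
    (d ≫ ((Bounded.ι (C := A)).commShiftIso (1 : ℤ)).inv.app X)
  have hδ' : Bounded.ι.map δ ≫ ((Bounded.ι (C := A)).commShiftIso (1 : ℤ)).hom.app X = d := by
    rw [hδ, Category.assoc, Iso.inv_hom_id_app]
    exact Category.comp_id _
  refine ⟨δ, ?_⟩
  rw [← hδ'] at h
  exact h

theorem exists_distTriang_single {S : ShortComplex A} (hS : S.ShortExact) (n : ℤ) :
    ∃ δ : (single A n).obj S.X₃ ⟶ ((single A n).obj S.X₁)⟦(1 : ℤ)⟧,
      Triangle.mk ((single A n).map S.f) ((single A n).map S.g) δ ∈ distTriang (Bounded A) :=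
  exists_distTriang_of_ι _ _ _ (DerivedCategory.triangleOfSES_distinguished
    (hS.map_of_exact (HomologicalComplex.single A (ComplexShape.up ℤ) n)))

/-- After a shift by `m`, such a morphism is a class in `Ext^k(X, Y)` with `k = m - n`. -/
theorem _root_.DerivedCategory.single_hom_eq_zero (X Y : A) (m n : ℤ) (k : ℕ) (hk : n + k = m)
    [HasProjectiveDimensionLT X k]
    (f : (DerivedCategory.singleFunctor A m).obj X ⟶ (DerivedCategory.singleFunctor A n).obj Y) :
    f = 0 := by
  let e₁ := ((DerivedCategory.singleFunctors A).shiftIso m 0 m (by lia)).app X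
  let e₂ := ((DerivedCategory.singleFunctors A).shiftIso m (n - m) n (by lia)).app Y
  let e₃ := ((DerivedCategory.singleFunctors A).shiftIso (k : ℤ) (n - m) 0 (by lia)).app Y
  let := HasExt.standard A
  have h : e₁.inv ≫ f⟦m⟧' ≫ e₂.hom ≫ e₃.inv = 0 := by
    obtain ⟨g, hg⟩ := (Abelian.Ext.homEquiv (X := X) (Y := Y) (n := k)).surjective
      (e₁.inv ≫ f⟦m⟧' ≫ e₂.hom ≫ e₃.inv)
    rw [← hg, g.eq_zero_of_hasProjectiveDimensionLT k le_rfl]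
    exact Abelian.Ext.zero_hom _ _ _
  apply (shiftFunctor (DerivedCategory A) m).map_injective
  rw [Functor.map_zero, ← cancel_mono (e₂.hom ≫ e₃.inv), ← cancel_epi e₁.inv, h, zero_comp,
    comp_zero]

theorem single_hom_eq_zero_of_lt {X Y : A} {m n : ℤ} (h : m < n)
    (f : (single A m).obj X ⟶ (single A n).obj Y) : f = 0 :=
  (Bounded.ι (C := A)).map_injective (by
    rw [Functor.map_zero]
    exact TStructure.t.zero (X := (DerivedCategory.singleFunctor A m).obj X)
      (Y := (DerivedCategory.singleFunctor A n).obj Y) _ m n h)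

theorem single_hom_eq_zero_of_hasProjectiveDimensionLT {X Y : A} {m n : ℤ} (k : ℕ)
    [HasProjectiveDimensionLT X k] (h : n + k ≤ m)
    (f : (single A m).obj X ⟶ (single A n).obj Y) : f = 0 := by
  obtain ⟨j, hj⟩ := Int.eq_ofNat_of_zero_le (show 0 ≤ m - n by lia)
  have := hasProjectiveDimensionLT_of_ge X k j (by lia)
  exact (Bounded.ι (C := A)).map_injective (by
    rw [Functor.map_zero]
    exact DerivedCategory.single_hom_eq_zero X Y m n j (by lia) _)

theorem single_hom_eq_zero (hA : IsHereditary A) {X Y : A} {m n : ℤ} (h : n + 2 ≤ m)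
    (f : (single A m).obj X ⟶ (single A n).obj Y) : f = 0 :=
  have : HasProjectiveDimensionLT X 2 := hA X
  single_hom_eq_zero_of_hasProjectiveDimensionLT 2 h f

theorem single_hom_eq_zero_of_projective {X Y : A} [Projective X] {m n : ℤ} (h : m ≠ n)
    (f : (single A m).obj X ⟶ (single A n).obj Y) : f = 0 := by
  rcases h.lt_or_gt with h | h
  · exact single_hom_eq_zero_of_lt h f
  · exact single_hom_eq_zero_of_hasProjectiveDimensionLT 1 (by push_cast; lia) f

section HomologySequence

variable (T : Triangle (Bounded A)) (hT : T ∈ distTriang (Bounded A))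

/-- The connecting morphism of the long exact cohomology sequence. -/
noncomputable def homologyδ (n₀ n₁ : ℤ) (h : n₀ + 1 = n₁) :
    (homology A n₀).obj T.obj₃ ⟶ (homology A n₁).obj T.obj₁ :=
  (homology A 0).homologySequenceδ T n₀ n₁ h

include hT

theorem comp_homologyδ (n₀ n₁ : ℤ) (h : n₀ + 1 = n₁) :
    (homology A n₀).map T.mor₂ ≫ homologyδ T n₀ n₁ h = 0 :=
  (homology A 0).comp_homologySequenceδ T hT n₀ n₁ h

theorem homologyδ_comp (n₀ n₁ : ℤ) (h : n₀ + 1 = n₁) :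
    homologyδ T n₀ n₁ h ≫ (homology A n₁).map T.mor₁ = 0 :=
  (homology A 0).homologySequenceδ_comp T hT n₀ n₁ h

theorem homology_comp (n : ℤ) : (homology A n).map T.mor₁ ≫ (homology A n).map T.mor₂ = 0 :=
  (homology A 0).homologySequence_comp T hT n

theorem homology_exact₂ (n : ℤ) : (ShortComplex.mk _ _ (homology_comp T hT n)).Exact :=
  (homology A 0).homologySequence_exact₂ T hT n

theorem homology_exact₃ (n₀ n₁ : ℤ) (h : n₀ + 1 = n₁) :
    (ShortComplex.mk _ _ (comp_homologyδ T hT n₀ n₁ h)).Exact :=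
  (homology A 0).homologySequence_exact₃ T hT n₀ n₁ h

theorem homology_exact₁ (n₀ n₁ : ℤ) (h : n₀ + 1 = n₁) :
    (ShortComplex.mk _ _ (homologyδ_comp T hT n₀ n₁ h)).Exact :=
  (homology A 0).homologySequence_exact₁ T hT n₀ n₁ h

/-- The middle object has vanishing cohomology where the outer ones do. -/
theorem isZero_homology₂ (n : ℤ) (h₁ : IsZero ((homology A n).obj T.obj₁))
    (h₃ : IsZero ((homology A n).obj T.obj₃)) : IsZero ((homology A n).obj T.obj₂) :=
  (homology_exact₂ T hT n).isZero_of_both_isZero h₁ h₃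

theorem isIso_homology_mor₁ (n₀ n : ℤ) (h : n₀ + 1 = n)
    (h₀ : IsZero ((homology A n₀).obj T.obj₃)) (h₁ : IsZero ((homology A n).obj T.obj₃)) :
    IsIso ((homology A n).map T.mor₁) := by
  have : Mono ((homology A n).map T.mor₁) :=
    (homology_exact₁ T hT n₀ n h).mono_g (h₀.eq_of_src _ _)
  have : Epi ((homology A n).map T.mor₁) := (homology_exact₂ T hT n).epi_f (h₁.eq_of_tgt _ _)
  exact isIso_of_mono_of_epi _

theorem isIso_homology_mor₂ (n n₁ : ℤ) (h : n + 1 = n₁)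
    (h₀ : IsZero ((homology A n).obj T.obj₁)) (h₁ : IsZero ((homology A n₁).obj T.obj₁)) :
    IsIso ((homology A n).map T.mor₂) := by
  have : Mono ((homology A n).map T.mor₂) := (homology_exact₂ T hT n).mono_g (h₀.eq_of_src _ _)
  have : Epi ((homology A n).map T.mor₂) :=
    (homology_exact₃ T hT n n₁ h).epi_f (h₁.eq_of_tgt _ _)
  exact isIso_of_mono_of_epi _

end HomologySequence

/-- The truncation triangles of the canonical t-structure, in terms of cohomology. -/
theorem exists_truncation (X : Bounded A) (n : ℤ) :
    ∃ (X₁ X₂ : Bounded A) (f : X₁ ⟶ X) (g : X ⟶ X₂) (h : X₂ ⟶ X₁⟦(1 : ℤ)⟧),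
      Triangle.mk f g h ∈ distTriang (Bounded A) ∧
      (∀ m, n < m → IsZero ((homology A m).obj X₁)) ∧
      (∀ m, m ≤ n → IsZero ((homology A m).obj X₂)) := by
  obtain ⟨X₁, X₂, h₁, h₂, f, g, h, hT⟩ :=
    (TStructure.t (C := A)).onBounded.exists_triangle X n (n + 1) rfl
  exact ⟨X₁, X₂, f, g, h, hT, fun m hm ↦ (DerivedCategory.isLE_iff _ n).1 ⟨h₁⟩ m hm,
    fun m hm ↦ (DerivedCategory.isGE_iff _ (n + 1)).1 ⟨h₂⟩ m (by lia)⟩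

theorem exists_bounds (X : Bounded A) :
    ∃ (a : ℤ) (N : ℕ), ∀ m, IsZero ((homology A m).obj X) ∨ (a ≤ m ∧ m < a + N) := by
  obtain ⟨⟨a, ha⟩, ⟨b, hb⟩⟩ := X.property
  refine ⟨a, (b + 1 - a).toNat, fun m ↦ ?_⟩
  by_cases h₁ : m < a
  · exact Or.inl ((DerivedCategory.isGE_iff _ a).1 ha m h₁)
  by_cases h₂ : b < m
  · exact Or.inl ((DerivedCategory.isLE_iff _ b).1 hb m h₂)
  exact Or.inr (by lia)

theorem isZero_of_isZero_homology (X : Bounded A) (h : ∀ m, IsZero ((homology A m).obj X)) :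
    IsZero X := by
  obtain ⟨e⟩ := nonempty_iso_single X 0 fun m _ ↦ h m
  exact ((single A 0).map_isZero (h 0)).of_iso e

/-- Dévissage: a property of objects of `D^b A` that is closed under extensions holds for `X` as
soon as it holds for the cohomology objects of `X`. The extensions to be considered are
those of objects with cohomology in degrees `> n` by objects in degree `n`. -/
theorem devissage (P : ObjectProperty (Bounded A)) [P.IsClosedUnderIsomorphisms]
    (h₀ : ∀ X, IsZero X → P X)
    (h₂ : ∀ (n : ℤ) (T : Triangle (Bounded A)), T ∈ distTriang (Bounded A) →
      (∀ m, m ≠ n → IsZero ((homology A m).obj T.obj₁)) →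
      (∀ m, m ≤ n → IsZero ((homology A m).obj T.obj₃)) → P T.obj₁ → P T.obj₃ → P T.obj₂)
    (X : Bounded A) (hX : ∀ n, P ((single A n).obj ((homology A n).obj X))) : P X := by
  obtain ⟨a, N, hN⟩ := exists_bounds X
  -- Induction on the length of the interval `[a, a + N)` containing the nonzero cohomology:
  -- truncating at `a` splits off the lowest degree.
  induction N generalizing X a with
  | zero => exact h₀ X (isZero_of_isZero_homology X fun m ↦ (hN m).resolve_right (by simp))
  | succ N ih =>
    obtain ⟨X₁, X₂, f, g, h, hT, hX₁, hX₂⟩ := exists_truncation X a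
    have hf (m : ℤ) (hm : m ≤ a) : IsIso ((homology A m).map f) :=
      isIso_homology_mor₁ _ hT (m - 1) m (by lia) (hX₂ _ (by lia)) (hX₂ _ hm)
    have hg (m : ℤ) (hm : a < m) : IsIso ((homology A m).map g) :=
      isIso_homology_mor₂ _ hT m (m + 1) rfl (hX₁ _ hm) (hX₁ _ (by lia))
    have hX₁' (m : ℤ) (hm : m ≠ a) : IsZero ((homology A m).obj X₁) := by
      rcases hm.lt_or_gt with hm | hm
      · have := hf m hm.le
        exact ((hN m).resolve_right (by lia)).of_iso (asIso ((homology A m).map f))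
      · exact hX₁ m hm
    refine h₂ a _ hT hX₁' hX₂ ?_ (ih X₂ (fun n ↦ ?_) (a + 1) fun m ↦ ?_)
    · obtain ⟨e⟩ := nonempty_iso_single X₁ a hX₁'
      have := hf a le_rfl
      exact P.prop_of_iso
        (e ≪≫ (single A a).mapIso (asIso ((homology A a).map f))).symm (hX a)
    · by_cases hn : n ≤ a
      · exact h₀ _ ((single A n).map_isZero (hX₂ n hn))
      · have := hg n (by lia)
        exact P.prop_of_iso ((single A n).mapIso (asIso ((homology A n).map g))) (hX n)
    · by_cases hm : m ≤ a
      · exact Or.inl (hX₂ m hm)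
      · have := hg m (by lia)
        rcases hN m with h | h
        · exact Or.inl (h.of_iso (asIso ((homology A m).map g)).symm)
        · push_cast at h
          exact Or.inr (by lia)

/-- The objects receiving no nonzero map from `U` are closed under extensions, so dévissage applies.
-/
theorem hom_eq_zero_of_target {U : Bounded A} (X : Bounded A)
    (h : ∀ n (f : U ⟶ (single A n).obj ((homology A n).obj X)), f = 0) (f : U ⟶ X) : f = 0 := by
  let P : ObjectProperty (Bounded A) := fun X ↦ ∀ f : U ⟶ X, f = 0
  have : P.IsClosedUnderIsomorphisms :=
    ⟨fun e hX f ↦ by rw [← cancel_mono e.inv, hX (f ≫ e.inv), zero_comp]⟩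
  refine devissage P (fun X hX f ↦ hX.eq_of_tgt _ _) (fun n T hT _ _ h₁ h₃ f ↦ ?_) X h f
  obtain ⟨g, rfl⟩ := Triangle.coyoneda_exact₂ _ hT f (h₃ _)
  rw [h₁ g, zero_comp]

theorem hom_eq_zero_of_source {U : Bounded A} (X : Bounded A)
    (h : ∀ n (f : (single A n).obj ((homology A n).obj X) ⟶ U), f = 0) (f : X ⟶ U) : f = 0 := by
  let P : ObjectProperty (Bounded A) := fun X ↦ ∀ f : X ⟶ U, f = 0
  have : P.IsClosedUnderIsomorphisms :=
    ⟨fun e hX f ↦ by rw [← cancel_epi e.hom, hX (e.hom ≫ f), comp_zero]⟩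
  refine devissage P (fun X hX f ↦ hX.eq_of_src _ _) (fun n T hT _ _ h₁ h₃ f ↦ ?_) X h f
  obtain ⟨g, rfl⟩ := Triangle.yoneda_exact₂ _ hT f (h₁ _)
  rw [h₃ g, comp_zero]

/-- Over a hereditary category, every bounded complex is the direct sum of its cohomology. This
is expressed as an induction principle. -/
theorem biprod_induction (hA : IsHereditary A) (P : ObjectProperty (Bounded A))
    [P.IsClosedUnderIsomorphisms] (h₀ : ∀ X, IsZero X → P X)
    (h₂ : ∀ X Y, P X → P Y → P (X ⊞ Y))
    (X : Bounded A) (hX : ∀ n, P ((single A n).obj ((homology A n).obj X))) : P X := by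
  refine devissage P h₀ (fun n T hT hT₁ hT₃ h₁ h₃ ↦ ?_) X hX
  -- The target sits in degree `n - 1` and the cohomology of the source in degrees `> n`, so only
  -- `Ext^i` with `i ≥ 2` could contribute.
  have hδ : T.mor₃ = 0 := by
    obtain ⟨e⟩ := nonempty_iso_single _ n hT₁
    let e' := (shiftFunctor (Bounded A) (1 : ℤ)).mapIso e ≪≫ singleShift _ 1 n (n - 1) (by lia)
    rw [← cancel_mono e'.hom, zero_comp]
    refine hom_eq_zero_of_source _ (fun m f ↦ ?_) _
    by_cases hm : m ≤ n
    · exact ((single A m).map_isZero (hT₃ m hm)).eq_of_src _ _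
    · exact single_hom_eq_zero hA (by lia) f
  obtain ⟨e, -⟩ := exists_iso_binaryBiproduct_of_distTriang T hT hδ
  exact P.prop_of_iso e.symm (h₂ _ _ h₁ h₃)

end DerivedCategory.Bounded

/-! ### Reflections in full subcategories. -/

namespace CategoryTheory.ObjectProperty

/-- The object `X` has a reflection in the full subcategory `P`. -/
def HasReflection {A : Type*} [Category* A] (P : ObjectProperty A) (X : A) : Prop :=
  ∃ (L : A) (_ : P L) (η : X ⟶ L), ∀ W, P W → Function.Bijective (fun g : L ⟶ W ↦ η ≫ g)

theorem HasReflection.of_iso {A : Type*} [Category* A] {P : ObjectProperty A} {X Y : A}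
    (h : P.HasReflection X) (e : X ≅ Y) : P.HasReflection Y := by
  obtain ⟨L, hL, η, hη⟩ := h
  refine ⟨L, hL, e.inv ≫ η, fun W hW ↦ ⟨fun g g' hg ↦ (hη W hW).1 ?_, fun f ↦ ?_⟩⟩
  · simpa using hg
  · obtain ⟨g, hg : η ≫ g = _⟩ := (hη W hW).2 (e.hom ≫ f)
    exact ⟨g, by simp [hg]⟩

theorem HasReflection.biprod {A : Type*} [Category* A] [HasZeroMorphisms A]
    [HasBinaryBiproducts A] {P : ObjectProperty A} (hP : ∀ X Y, P X → P Y → P (X ⊞ Y)) {X Y : A}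
    (hX : P.HasReflection X) (hY : P.HasReflection Y) : P.HasReflection (X ⊞ Y) := by
  obtain ⟨L, hL, η, hη⟩ := hX
  obtain ⟨L', hL', η', hη'⟩ := hY
  refine ⟨L ⊞ L', hP _ _ hL hL', biprod.map η η', fun W hW ↦ ⟨fun g g' hg ↦ ?_, fun f ↦ ?_⟩⟩
  · have hg₁ : biprod.map η η' ≫ g = biprod.map η η' ≫ g' := hg
    apply biprod.hom_ext'
    · apply (hη W hW).1
      simpa using biprod.inl ≫= hg₁
    · apply (hη' W hW).1
      simpa using biprod.inr ≫= hg₁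
  · obtain ⟨g, hg : η ≫ g = _⟩ := (hη W hW).2 (biprod.inl ≫ f)
    obtain ⟨g', hg' : η' ≫ g' = _⟩ := (hη' W hW).2 (biprod.inr ≫ f)
    exact ⟨biprod.desc g g', by apply biprod.hom_ext' <;> simp [hg, hg']⟩

theorem HasReflection.of_leftOrthogonal {A : Type*} [Category* A] [HasZeroMorphisms A]
    [HasZeroObject A] {P : ObjectProperty A} (h₀ : P 0) {X : A} (hX : P.leftOrthogonal X) :
    P.HasReflection X :=
  ⟨0, h₀, 0, fun _ hW ↦ ⟨fun _ _ _ ↦ (isZero_zero A).eq_of_src _ _,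
    fun f ↦ ⟨0, by rw [hX f hW]; exact comp_zero⟩⟩⟩

/-- A full subcategory is reflective if and only if every object has a reflection. -/
theorem isRightAdjoint_ι_iff {A : Type u} [Category.{v} A] (P : ObjectProperty A) :
    P.ι.IsRightAdjoint ↔ ∀ X : A, P.HasReflection X := by
  constructor
  · intro _ X
    let adj := Adjunction.ofIsRightAdjoint P.ι
    refine ⟨(P.ι.leftAdjoint.obj X).obj, (P.ι.leftAdjoint.obj X).property, adj.unit.app X,
      fun W hW ↦ ?_⟩
    have h (g : P.ι.leftAdjoint.obj X ⟶ ⟨W, hW⟩) :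
        adj.homEquiv X ⟨W, hW⟩ g = adj.unit.app X ≫ g.hom :=
      adj.homEquiv_unit _ _ _
    refine ⟨fun g g' hg ↦ ?_, fun g ↦ ?_⟩
    · have hg' : homMk g = homMk g' := (adj.homEquiv X ⟨W, hW⟩).injective
        ((h (homMk g)).trans (Eq.trans hg (h (homMk g')).symm))
      exact congrArg (fun k ↦ k.hom) hg'
    · obtain ⟨k, hk⟩ := (adj.homEquiv X ⟨W, hW⟩).surjective g
      exact ⟨k.hom, (h k).symm.trans hk⟩
  · intro h
    choose L hL η hη using h
    let e (X : A) (Y : P.FullSubcategory) :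
        ((⟨L X, hL X⟩ : P.FullSubcategory) ⟶ Y) ≃ (X ⟶ P.ι.obj Y) :=
      P.fullyFaithfulι.homEquiv.trans (Equiv.ofBijective _ (hη X Y.obj Y.property))
    exact (Adjunction.adjunctionOfEquivLeft e (fun X Y Y' g h ↦ by
      exact (Category.assoc (η X) h.hom g.hom).symm)).isRightAdjoint

end CategoryTheory.ObjectProperty

namespace CategoryTheory.ObjectProperty

variable {D : Type*} [Category* D] [Preadditive D] [HasZeroObject D] [HasShift D ℤ]
  [∀ n : ℤ, (shiftFunctor D n).Additive] [Pretriangulated D]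

theorem HasReflection.extensionProduct {V : ObjectProperty D} [V.IsTriangulatedClosed₂] {X : D}
    (h : V.HasReflection X) : extensionProduct V.leftOrthogonal V X := by
  obtain ⟨R, hR, η, hη⟩ := h
  obtain ⟨N, i, δ, hT⟩ := distinguished_cocone_triangle₁ η
  exact ⟨N, R, i, η, δ, hT, V.leftOrthogonal_of_bijective hT hR hη, hR⟩

/-- Orthogonality of the fibre `N` gives existence of factorizations. Uniqueness also needs maps
`N⟦1⟧ ⟶ Y` to vanish, which is where stability under the shift by `-1` enters. -/
theorem hasReflection_of_extensionProduct {V : ObjectProperty D}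
    (hV : ∀ X, V X → V (X⟦(-1 : ℤ)⟧)) {X : D} (h : extensionProduct V.leftOrthogonal V X) :
    V.HasReflection X := by
  obtain ⟨N, R, i, η, δ, hT, hN, hR⟩ := h
  refine ⟨R, hR, η, fun Y hY ↦ ⟨fun g g' hg ↦ ?_, fun f ↦ ?_⟩⟩
  · have h0 : η ≫ (g - g') = 0 := by rw [Preadditive.comp_sub]; exact sub_eq_zero.2 hg
    obtain ⟨k, hk⟩ : ∃ k : N⟦(1 : ℤ)⟧ ⟶ Y, g - g' = δ ≫ k := Triangle.yoneda_exact₃ _ hT _ h0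
    let e : (Y⟦(-1 : ℤ)⟧)⟦(1 : ℤ)⟧ ≅ Y := (shiftFunctorCompIsoId D (-1 : ℤ) 1 (by lia)).app Y
    obtain ⟨k', hk'⟩ := (shiftFunctor D (1 : ℤ)).map_surjective (k ≫ e.inv)
    have hk₀ : k = 0 := by
      rw [hN k' (hV _ hY), Functor.map_zero] at hk'
      rw [← cancel_mono e.inv, ← hk', zero_comp]
    rw [hk₀, comp_zero] at hk
    exact sub_eq_zero.1 hk
  · obtain ⟨k, hk⟩ := Triangle.yoneda_exact₂ _ hT f (hN _ hY)
    exact ⟨k, hk.symm⟩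

end CategoryTheory.ObjectProperty

/-! ### Cohomology objects as direct summands. -/

namespace DerivedCategory.Bounded

variable {A : Type u} [Category.{v} A] [Abelian A] [HasDerivedCategory.{w} A]

/-- The object `X` placed in degree `n` has cohomology `X` in degree `n`. -/
noncomputable def homologySingle (n : ℤ) (X : A) :
    (homology A n).obj ((single A n).obj X) ≅ X :=
  (singleCompHomology A n).app X

theorem homologySingle_hom_naturality (n : ℤ) {X Y : A} (f : X ⟶ Y) :
    (homology A n).map ((single A n).map f) ≫ (homologySingle n Y).hom =
      (homologySingle n X).hom ≫ f :=
  (singleCompHomology A n).hom.naturality f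

theorem homologySingle_inv_naturality (n : ℤ) {X Y : A} (f : X ⟶ Y) :
    f ≫ (homologySingle n Y).inv =
      (homologySingle n X).inv ≫ (homology A n).map ((single A n).map f) :=
  (singleCompHomology A n).inv.naturality f

theorem homology_map_comp {X Y Z : Bounded A} {f : X ⟶ Y} {g : Y ⟶ Z} {δ : Z ⟶ X⟦(1 : ℤ)⟧}
    (hT : Triangle.mk f g δ ∈ distTriang (Bounded A)) (n : ℤ) :
    (homology A n).map f ≫ (homology A n).map g = 0 :=
  homology_comp _ hT n

theorem homology_map_exact {X Y Z : Bounded A} {f : X ⟶ Y} {g : Y ⟶ Z} {δ : Z ⟶ X⟦(1 : ℤ)⟧}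
    (hT : Triangle.mk f g δ ∈ distTriang (Bounded A)) (n : ℤ) :
    (ShortComplex.mk _ _ (homology_map_comp hT n)).Exact :=
  homology_exact₂ _ hT n

/-- Over a hereditary category, each cohomology object is a direct summand. -/
theorem exists_retract_single (hA : IsHereditary A) (X : Bounded A) (n : ℤ) :
    ∃ (p : X ⟶ (single A n).obj ((homology A n).obj X))
      (i : (single A n).obj ((homology A n).obj X) ⟶ X), i ≫ p = 𝟙 _ ∧
      (homology A n).map p ≫ (homologySingle n _).hom = 𝟙 _ := by
  -- Leaving the summand `B` free makes the property pass to biproducts; the two identities force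
  -- `B` to be the `n`-th cohomology.
  suffices h : ∃ (B : A) (p : X ⟶ (single A n).obj B) (i : (single A n).obj B ⟶ X),
      i ≫ p = 𝟙 _ ∧ (homology A n).map (p ≫ i) = 𝟙 _ by
    obtain ⟨B, p, i, hip, hpi⟩ := h
    let φ : (homology A n).obj X ≅ B :=
      { hom := (homology A n).map p ≫ (homologySingle n B).hom
        inv := (homologySingle n B).inv ≫ (homology A n).map i
        hom_inv_id := by
          rw [Category.assoc, Iso.hom_inv_id_assoc, ← Functor.map_comp, hpi]
        inv_hom_id := by
          rw [Category.assoc, ← Functor.map_comp_assoc, hip, CategoryTheory.Functor.map_id, Category.id_comp,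
            Iso.inv_hom_id] }
    refine ⟨p ≫ (single A n).map φ.inv, (single A n).map φ.hom ≫ i, ?_, ?_⟩
    · rw [Category.assoc, reassoc_of% hip, ← Functor.map_comp, φ.hom_inv_id, CategoryTheory.Functor.map_id]
    · rw [Functor.map_comp, Category.assoc, homologySingle_hom_naturality, ← φ.hom_inv_id,
        Category.assoc]
  let P : ObjectProperty (Bounded A) := fun X ↦
    ∃ (B : A) (p : X ⟶ (single A n).obj B) (i : (single A n).obj B ⟶ X),
      i ≫ p = 𝟙 _ ∧ (homology A n).map (p ≫ i) = 𝟙 _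
  have : P.IsClosedUnderIsomorphisms := ⟨by
    rintro X Y e ⟨B, p, i, hip, hpi⟩
    refine ⟨B, e.inv ≫ p, i ≫ e.hom, by simp [hip], ?_⟩
    have h : (e.inv ≫ p) ≫ i ≫ e.hom = e.inv ≫ (p ≫ i) ≫ e.hom := by simp
    rw [h, Functor.map_comp, Functor.map_comp, hpi, Category.id_comp, ← Functor.map_comp,
      e.inv_hom_id, CategoryTheory.Functor.map_id]⟩
  refine biprod_induction hA P (fun X hX ↦ ?_) ?_ X (fun m ↦ ?_)
  · exact ⟨0, 0, 0, ((single A n).map_isZero (isZero_zero A)).eq_of_src _ _,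
      ((homology A n).map_isZero hX).eq_of_src _ _⟩
  · rintro X Y ⟨B, p, i, hip, hpi⟩ ⟨B', p', i', hip', hpi'⟩
    have : PreservesBinaryBiproducts (single A n) :=
      preservesBinaryBiproducts_of_preservesBiproducts _
    let e := (single A n).mapBiprod B B'
    refine ⟨B ⊞ B', biprod.map p p' ≫ e.inv, e.hom ≫ biprod.map i i', ?_, ?_⟩
    · have h : biprod.map i i' ≫ biprod.map p p' = 𝟙 _ := by
        apply biprod.hom_ext' <;> apply biprod.hom_ext <;> simp [hip, hip']
      rw [Category.assoc, reassoc_of% h, e.hom_inv_id]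
    · have h : (biprod.map p p' ≫ e.inv) ≫ e.hom ≫ biprod.map i i' =
          biprod.fst ≫ (p ≫ i) ≫ biprod.inl + biprod.snd ≫ (p' ≫ i') ≫ biprod.inr := by
        rw [Category.assoc, e.inv_hom_id_assoc]
        apply biprod.hom_ext' <;> apply biprod.hom_ext <;> simp
      rw [h, Functor.map_add, Functor.map_comp, Functor.map_comp, hpi, Functor.map_comp,
        Functor.map_comp, hpi', Category.id_comp, Category.id_comp, ← Functor.map_comp,
        ← Functor.map_comp, ← Functor.map_add, biprod.total, CategoryTheory.Functor.map_id]
  · by_cases hm : n = m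
    · subst hm
      exact ⟨_, 𝟙 _, 𝟙 _, by simp, by simp⟩
    · exact ⟨0, 0, 0, ((single A n).map_isZero (isZero_zero A)).eq_of_src _ _,
        (isZero_homology_single _ hm).eq_of_src _ _⟩

end DerivedCategory.Bounded

/-! ### Co-narrow sequences reindexed by cohomological degree. -/

/-- Cohomologically indexed families of subcategories satisfying the closure conditions of a
co-narrow sequence and containing the zero objects. -/
structure IsCoNarrowFamily {A : Type u} [Category.{v} A] [Abelian A]
    (F : ℤ → ObjectProperty A) : Prop where
  of_isZero (n : ℤ) {X : A} (hX : IsZero X) : F n X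
  le_succ (n : ℤ) : F n ≤ F (n + 1)
  of_exact (n : ℤ) {X₁ X₂ X₃ X₄ X₅ : A}
    (f₁ : X₁ ⟶ X₂) (f₂ : X₂ ⟶ X₃) (f₃ : X₃ ⟶ X₄) (f₄ : X₄ ⟶ X₅)
    (w₂ : f₁ ≫ f₂ = 0) (w₃ : f₂ ≫ f₃ = 0) (w₄ : f₃ ≫ f₄ = 0)
    (exact₂ : (ShortComplex.mk f₁ f₂ w₂).Exact)
    (exact₃ : (ShortComplex.mk f₂ f₃ w₃).Exact)
    (exact₄ : (ShortComplex.mk f₃ f₄ w₄).Exact)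
    (h₁ : F (n - 1) X₁) (h₂ : F n X₂) (h₄ : F n X₄) (h₅ : F (n + 1) X₅) : F n X₃

namespace IsCoNarrowFamily

variable {A : Type u} [Category.{v} A] [Abelian A]

/-- Closure under extensions and cokernels in the opposite category is the five-term condition
padded with zeros; for cokernels, `le_succ` first moves the source one index up. -/
theorem isCoNarrowSequence {C : ℤ → ObjectProperty A}
    (hC : IsCoNarrowFamily fun n ↦ C (-n)) : IsCoNarrowSequence C := by
  have of_exact (k : ℤ) {X₁ X₂ X₃ X₄ X₅ : Aᵒᵖ}
      (f₁ : X₁ ⟶ X₂) (f₂ : X₂ ⟶ X₃) (f₃ : X₃ ⟶ X₄) (f₄ : X₄ ⟶ X₅)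
      (w₂ : f₁ ≫ f₂ = 0) (w₃ : f₂ ≫ f₃ = 0) (w₄ : f₃ ≫ f₄ = 0)
      (exact₂ : (ShortComplex.mk f₁ f₂ w₂).Exact)
      (exact₃ : (ShortComplex.mk f₂ f₃ w₃).Exact)
      (exact₄ : (ShortComplex.mk f₃ f₄ w₄).Exact)
      (h₁ : (C (-(k + 1))).op X₁) (h₂ : (C (-k)).op X₂) (h₄ : (C (-k)).op X₄)
      (h₅ : (C (-(k - 1))).op X₅) : (C (-k)).op X₃ :=
    hC.of_exact k f₄.unop f₃.unop f₂.unop f₁.unop (Quiver.Hom.op_inj w₄) (Quiver.Hom.op_inj w₃)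
      (Quiver.Hom.op_inj w₂) exact₄.unop exact₃.unop exact₂.unop h₅ h₄ h₂ h₁
  have hz (k : ℤ) : (C (-k)).op (0 : Aᵒᵖ) := hC.of_isZero k (isZero_zero Aᵒᵖ).unop
  exact
    { narrow k :=
        { extensions :=
            ⟨fun {S} hS h₁ h₃ ↦ by
              have hm := hS.mono_f
              have he := hS.epi_g
              exact of_exact k (0 : 0 ⟶ S.X₁) S.f S.g (0 : S.X₃ ⟶ 0) (by simp) S.zero (by simp)
                ((ShortComplex.exact_iff_mono _ rfl).2 hm) hS.exact
                ((ShortComplex.exact_iff_epi _ rfl).2 he) (hz _) h₁ h₃ (hz _)⟩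
          cokernels := ⟨by
            rintro _ ⟨f, c, hc, hX, hY⟩
            have hX' : (C (-(k + 1))).op _ := hC.le_succ k _ hX
            have := Cofork.IsColimit.epi hc
            exact of_exact k f c.π (0 : _ ⟶ (0 : Aᵒᵖ)) (0 : (0 : Aᵒᵖ) ⟶ (0 : Aᵒᵖ)) (CokernelCofork.condition c) (by simp) (by simp)
              (ShortComplex.exact_of_g_is_cokernel _ (IsColimit.ofIsoColimit hc (Cofork.ext (Iso.refl _))))
              ((ShortComplex.exact_iff_epi _ rfl).2 this)
              (ShortComplex.exact_of_isZero_X₂ _ (isZero_zero _)) hX' hY (hz _) (hz _)⟩ }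
      le_succ k X hX := hC.le_succ k _ hX
      of_exact k _ _ _ _ _ f₁ f₂ f₃ f₄ := of_exact k f₁ f₂ f₃ f₄ }

end IsCoNarrowFamily

/-- Nonemptiness cannot be dropped, since the sequence of empty subcategories is co-narrow. Given a
member, a zero object is the cokernel of its identity. -/
theorem IsCoNarrowSequence.isCoNarrowFamily {A : Type u} [Category.{v} A] [Abelian A]
    {C : ℤ → ObjectProperty A} (hC : IsCoNarrowSequence C) (h : ∀ k, ∃ X, C k X) :
    IsCoNarrowFamily fun n ↦ C (-n) where
  of_isZero n X hX := by
    obtain ⟨Y, hY⟩ := h (-n)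
    have := (hC.narrow n).cokernels
    have hc : IsColimit (CokernelCofork.ofπ (f := 𝟙 (Opposite.op Y))
        (0 : Opposite.op Y ⟶ Opposite.op X) (by simp)) :=
      CokernelCofork.IsColimit.ofπ _ _ (fun _ _ ↦ 0) (fun g hg ↦ by simpa using hg.symm)
        (fun _ _ _ _ ↦ hX.op.eq_of_src _ _)
    exact (C (-n)).op.prop_of_isColimit_cokernelCofork hc hY hY
  le_succ n X hX := hC.le_succ n (Opposite.op X) hX
  of_exact n _ _ _ _ _ f₁ f₂ f₃ f₄ w₂ w₃ w₄ e₂ e₃ e₄ h₁ h₂ h₄ h₅ :=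
    hC.of_exact n f₄.op f₃.op f₂.op f₁.op (Quiver.Hom.unop_inj w₄) (Quiver.Hom.unop_inj w₃)
      (Quiver.Hom.unop_inj w₂) e₄.op e₃.op e₂.op h₅ h₄ h₂ h₁

/-! ### From coaisles to reflective co-narrow sequences. -/

namespace CategoryTheory.ObjectProperty

variable {D : Type*} [Category* D] [Preadditive D] [HasZeroObject D] [HasShift D ℤ]
  [∀ n : ℤ, (shiftFunctor D n).Additive] [Pretriangulated D]

/-- The closure properties of the coaisle of a t-structure. -/
structure IsCoaisle (V : ObjectProperty D) : Prop where
  closed₂ : V.IsTriangulatedClosed₂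
  of_isZero {X : D} (hX : IsZero X) : V X
  of_retract {X Y : D} {i : X ⟶ Y} {p : Y ⟶ X} (h : i ≫ p = 𝟙 X) (hY : V Y) : V X
  shift {X : D} (hX : V X) : V (X⟦(-1 : ℤ)⟧)
  hasReflection (X : D) : V.HasReflection X

theorem IsCoaisle.isClosedUnderIsomorphisms {V : ObjectProperty D} (hV : V.IsCoaisle) :
    V.IsClosedUnderIsomorphisms :=
  ⟨fun e hX ↦ hV.of_retract e.inv_hom_id hX⟩

theorem IsCoaisle.biprod {V : ObjectProperty D} (hV : V.IsCoaisle) {X Y : D} (hX : V X)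
    (hY : V Y) : V (X ⊞ Y) :=
  have := hV.closed₂
  have := hV.isClosedUnderIsomorphisms
  V.ext_of_isTriangulatedClosed₂ _ (binaryBiproductTriangle_distinguished X Y) hX hY

end CategoryTheory.ObjectProperty

theorem CategoryTheory.Triangulated.TStructure.isCoaisle_ge_zero {D : Type*} [Category* D]
    [Preadditive D] [HasZeroObject D] [HasShift D ℤ] [∀ n : ℤ, (shiftFunctor D n).Additive]
    [Pretriangulated D] [IsTriangulated D] (t : TStructure D) : (t.ge 0).IsCoaisle where
  closed₂ := .mk' fun T hT h₁ h₃ ↦ by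
    have : t.IsGE T.obj₁ 0 := ⟨h₁⟩
    have : t.IsGE T.obj₃ 0 := ⟨h₃⟩
    exact (t.isGE₂ T hT 0 ‹_› ‹_›).ge
  of_isZero hX := (t.isGE_of_isZero hX 0).ge
  of_retract {X Y i p} h hY := by
    have hY' : t.IsGE Y 0 := ⟨hY⟩
    refine ((t.isGE_iff_orthogonal (-1) 0 (by lia) X).2 fun Z f hZ ↦ ?_).ge
    have hf : f ≫ i = 0 := (t.isGE_iff_orthogonal (-1) 0 (by lia) Y).1 hY' _ (f ≫ i) hZ
    rw [← Category.comp_id f, ← h, reassoc_of% hf, zero_comp]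
  shift {X} hX := by
    have : t.IsGE X 0 := ⟨hX⟩
    have := t.isGE_shift X 0 (-1) 1
    exact (t.isGE_of_ge _ 0 1).ge
  hasReflection X := by
    obtain ⟨N, R, hN, hR, i, η, δ, hT⟩ := t.exists_triangle X (-1) 0 (by lia)
    refine ObjectProperty.hasReflection_of_extensionProduct (fun X hX ↦ ?_)
      ⟨N, R, i, η, δ, hT, fun Y f hY ↦ ?_, hR⟩
    · have : t.IsGE X 0 := ⟨hX⟩
      have := t.isGE_shift X 0 (-1) 1
      exact (t.isGE_of_ge _ 0 1).ge
    · exact t.zero_of_isLE_of_isGE f (-1) 0 (by lia) ⟨hN⟩ ⟨hY⟩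

namespace DerivedCategory.Bounded

variable {A : Type u} [Category.{v} A] [Abelian A] [HasDerivedCategory.{w} A]
  {V : ObjectProperty (Bounded A)}

theorem prop_single_homology (hA : IsHereditary A) (hV : V.IsCoaisle) {X : Bounded A}
    (hX : V X) (n : ℤ) : V ((single A n).obj ((homology A n).obj X)) := by
  obtain ⟨p, i, h, -⟩ := exists_retract_single hA X n
  exact hV.of_retract h hX

theorem prop_of_single_homology (hA : IsHereditary A) (hV : V.IsCoaisle) {X : Bounded A}
    (hX : ∀ n, V ((single A n).obj ((homology A n).obj X))) : V X :=
  have := hV.isClosedUnderIsomorphisms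
  biprod_induction hA V (fun _ ↦ hV.of_isZero) (fun _ _ ↦ hV.biprod) X hX

/-- The fibre `K` of `X₂ ⟶ X₃` in degree `n` is an extension of `X₂` in degree `n` by `X₃` in degree
`n + 1`, so it lies in `V`; its `n`-th cohomology is the kernel `X₁`, and stalks of cohomology are
summands. -/
theorem prop_single_of_exact_mono (hA : IsHereditary A) (hV : V.IsCoaisle) (n : ℤ)
    {S : ShortComplex A} (hS : S.Exact) [Mono S.f] (h₂ : V ((single A n).obj S.X₂))
    (h₃ : V ((single A (n + 1)).obj S.X₃)) : V ((single A n).obj S.X₁) := by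
  have := hV.closed₂
  have := hV.isClosedUnderIsomorphisms
  obtain ⟨K, i, δ, hT⟩ := distinguished_cocone_triangle₁ ((single A n).map S.g)
  have hK : V K := V.ext_of_isTriangulatedClosed₂ _ (inv_rot_of_distTriang _ hT)
    (V.prop_of_iso (singleShift S.X₃ (-1) n (n + 1) (by lia)).symm h₃) h₂
  have w : ((homology A n).map i ≫ (homologySingle n S.X₂).hom) ≫ S.g = 0 := by
    rw [Category.assoc, ← homologySingle_hom_naturality, ← Category.assoc,
      homology_map_comp hT n, zero_comp]
  have hex : (ShortComplex.mk _ _ w).Exact := by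
    refine ShortComplex.exact_of_iso (ShortComplex.isoMk
      (S₁ := .mk _ _ (homology_map_comp hT n)) (S₂ := .mk _ _ w) (Iso.refl _) (homologySingle n S.X₂)
      (homologySingle n S.X₃) ?_ ?_) (homology_map_exact hT n)
    · exact Category.id_comp _
    · exact (homologySingle_hom_naturality n S.g).symm
  have : Mono ((homology A n).map i) := (homology_exact₁ _ hT (n - 1) n (by lia)).mono_g
    ((isZero_homology_single S.X₃ (by lia)).eq_of_src _ _)
  have hm : Mono ((homology A n).map i ≫ (homologySingle n S.X₂).hom) := mono_comp _ _
  have : Mono (ShortComplex.mk _ _ w).f := hm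
  exact V.prop_of_iso ((single A n).mapIso
    (IsLimit.conePointUniqueUpToIso hex.fIsKernel hS.fIsKernel))
    (prop_single_homology hA hV hK n)

/-- Dual argument with the cone, whose `n`-th cohomology is the cokernel; the shift moves `X₁` to
degree `n - 1`. -/
theorem prop_single_of_exact_epi (hA : IsHereditary A) (hV : V.IsCoaisle) (n : ℤ)
    {S : ShortComplex A} (hS : S.Exact) [Epi S.g] (h₁ : V ((single A (n - 1)).obj S.X₁))
    (h₂ : V ((single A n).obj S.X₂)) : V ((single A n).obj S.X₃) := by
  have := hV.closed₂
  have := hV.isClosedUnderIsomorphisms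
  obtain ⟨Z, p, δ, hT⟩ := distinguished_cocone_triangle ((single A n).map S.f)
  have hZ : V Z := V.ext_of_isTriangulatedClosed₂ _ (rot_of_distTriang _ hT) h₂
    (V.prop_of_iso (singleShift S.X₁ 1 n (n - 1) (by lia)).symm h₁)
  have w : S.f ≫ (homologySingle n S.X₂).inv ≫ (homology A n).map p = 0 := by
    rw [← Category.assoc, homologySingle_inv_naturality, Category.assoc, homology_map_comp hT n,
      comp_zero]
  have hex : (ShortComplex.mk _ _ w).Exact := by
    refine ShortComplex.exact_of_iso (ShortComplex.isoMk
      (S₁ := .mk _ _ (homology_map_comp hT n)) (S₂ := .mk _ _ w) (homologySingle n S.X₁)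
      (homologySingle n S.X₂) (Iso.refl _) ?_ ?_) (homology_map_exact hT n)
    · exact (homologySingle_hom_naturality n S.f).symm
    · exact (Iso.hom_inv_id_assoc _ _).trans (Category.comp_id _).symm
  have : Epi ((homology A n).map p) := (homology_exact₃ _ hT n (n + 1) rfl).epi_f
    ((isZero_homology_single S.X₁ (by lia)).eq_of_tgt _ _)
  have hm : Epi ((homologySingle n S.X₂).inv ≫ (homology A n).map p) := epi_comp _ _
  have : Epi (ShortComplex.mk _ _ w).g := hm
  exact V.prop_of_iso ((single A n).mapIso
    (IsColimit.coconePointUniqueUpToIso hex.gIsCokernel hS.gIsCokernel))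
    (prop_single_homology hA hV hZ n)

/-- In a five-term exact sequence, `X₃` is an extension of `image f₃`, the kernel of `f₄`, by
`kernel f₃`, the cokernel of `f₁`. The two preceding lemmas treat these ends. -/
theorem isCoNarrowFamily_of_isCoaisle (hA : IsHereditary A) (hV : V.IsCoaisle) :
    IsCoNarrowFamily fun n ↦ V.inverseImage (single A n) where
  of_isZero n X hX := hV.of_isZero ((single A n).map_isZero hX)
  le_succ n X hX := hV.isClosedUnderIsomorphisms.of_iso
    (singleShift X (-1) n (n + 1) (by lia)) (hV.shift hX)
  of_exact n X₁ X₂ X₃ X₄ X₅ f₁ f₂ f₃ f₄ w₂ w₃ w₄ e₂ e₃ e₄ h₁ h₂ h₄ h₅ := by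
    have := hV.closed₂
    have := hV.isClosedUnderIsomorphisms
    let I := ShortComplex.mk f₁ (kernel.lift f₃ f₂ w₃) (by
      rw [← cancel_mono (kernel.ι f₃), Category.assoc, kernel.lift_ι, w₂, zero_comp])
    let K := ShortComplex.mk (image.ι f₃) f₄ (by
      rw [← cancel_epi (factorThruImage f₃), image.fac_assoc, w₄, comp_zero])
    let E := ShortComplex.mk (kernel.ι f₃) (factorThruImage f₃) (by
      rw [← cancel_mono (image.ι f₃), Category.assoc, image.fac, kernel.condition, zero_comp])
    have hI : I.Exact := by
      let φ : I ⟶ ShortComplex.mk f₁ f₂ w₂ := { τ₁ := 𝟙 _, τ₂ := 𝟙 _, τ₃ := kernel.ι f₃ }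
      have : Epi φ.τ₁ := inferInstanceAs (Epi (𝟙 _))
      have : IsIso φ.τ₂ := inferInstanceAs (IsIso (𝟙 _))
      have : Mono φ.τ₃ := inferInstanceAs (Mono (kernel.ι f₃))
      exact (ShortComplex.exact_iff_of_epi_of_isIso_of_mono φ).2 e₂
    have hK : K.Exact := by
      let φ : ShortComplex.mk f₃ f₄ w₄ ⟶ K := { τ₁ := factorThruImage f₃, τ₂ := 𝟙 _, τ₃ := 𝟙 _ }
      have : Epi φ.τ₁ := inferInstanceAs (Epi (factorThruImage f₃))
      have : IsIso φ.τ₂ := inferInstanceAs (IsIso (𝟙 _))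
      have : Mono φ.τ₃ := inferInstanceAs (Mono (𝟙 _))
      exact (ShortComplex.exact_iff_of_epi_of_isIso_of_mono φ).1 e₄
    have hE : E.Exact := by
      let φ : E ⟶ ShortComplex.mk (kernel.ι f₃) f₃ (kernel.condition f₃) :=
        { τ₁ := 𝟙 _, τ₂ := 𝟙 _, τ₃ := image.ι f₃ }
      have : Epi φ.τ₁ := inferInstanceAs (Epi (𝟙 _))
      have : IsIso φ.τ₂ := inferInstanceAs (IsIso (𝟙 _))
      have : Mono φ.τ₃ := inferInstanceAs (Mono (image.ι f₃))
      exact (ShortComplex.exact_iff_of_epi_of_isIso_of_mono φ).2 (ShortComplex.exact_kernel f₃)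
    have : Epi I.g := e₃.epi_kernelLift
    have : Mono K.f := inferInstanceAs (Mono (image.ι f₃))
    have : Mono E.f := inferInstanceAs (Mono (kernel.ι f₃))
    have : Epi E.g := inferInstanceAs (Epi (factorThruImage f₃))
    obtain ⟨δ, hT⟩ := exists_distTriang_single (ShortComplex.ShortExact.mk hE) n
    exact V.ext_of_isTriangulatedClosed₂ _ hT (prop_single_of_exact_epi hA hV n hI h₁ h₂)
      (prop_single_of_exact_mono hA hV n hK h₄ h₅)

/-- The reflection of `X` is the `n`-th cohomology of the reflection `R` of its stalk. Uniqueness of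
factorizations descends from `R` because the projection `p` is a split epimorphism. -/
theorem isRightAdjoint_ι_of_isCoaisle (hA : IsHereditary A) (hV : V.IsCoaisle) (n : ℤ) :
    (V.inverseImage (single A n)).ι.IsRightAdjoint := by
  refine (ObjectProperty.isRightAdjoint_ι_iff _).2 fun X ↦ ?_
  obtain ⟨R, hR, η, hη⟩ := hV.hasReflection ((single A n).obj X)
  obtain ⟨p, i, hip, hp⟩ := exists_retract_single hA R n
  let ε := (homologySingle n X).inv ≫ (homology A n).map η
  have hεp : η ≫ p = (single A n).map ε := by
    obtain ⟨k, hk⟩ := (single A n).map_surjective (η ≫ p)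
    have h := homologySingle_hom_naturality n k
    rw [hk, Functor.map_comp, Category.assoc, hp, Category.comp_id] at h
    rw [← hk, ← (homologySingle n X).inv_hom_id_assoc k, ← h]
  refine ⟨(homology A n).obj R, prop_single_homology hA hV hR n, ε,
    fun W hW ↦ ⟨fun g g' hg ↦ ?_, fun g ↦ ?_⟩⟩
  · apply (single A n).map_injective
    rw [← Category.id_comp ((single A n).map g), ← Category.id_comp ((single A n).map g'), ← hip,
      Category.assoc, Category.assoc]
    congr 1
    apply (hη _ hW).1
    change η ≫ p ≫ _ = η ≫ p ≫ _
    rw [← Category.assoc, ← Category.assoc, hεp, ← Functor.map_comp, ← Functor.map_comp]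
    exact congrArg _ hg
  · obtain ⟨h, hh : η ≫ h = _⟩ := (hη _ hW).2 ((single A n).map g)
    refine ⟨(homology A n).map h ≫ (homologySingle n W).hom, ?_⟩
    change ((homologySingle n X).inv ≫ _) ≫ _ = _
    rw [Category.assoc, ← Functor.map_comp_assoc, hh, homologySingle_hom_naturality,
      Iso.inv_hom_id_assoc]

end DerivedCategory.Bounded

/-! ### From reflective co-narrow families to coaisles. -/

namespace IsCoNarrowFamily

variable {A : Type u} [Category.{v} A] [Abelian A] {F : ℤ → ObjectProperty A}

theorem of_exact_mono (hF : IsCoNarrowFamily F) (n : ℤ) {S : ShortComplex A} (hS : S.Exact)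
    [Mono S.f] (h₂ : F n S.X₂) (h₃ : F (n + 1) S.X₃) : F n S.X₁ :=
  hF.of_exact n (0 : (0 : A) ⟶ 0) (0 : 0 ⟶ S.X₁) S.f S.g (by simp) (by simp) S.zero
    (ShortComplex.exact_of_isZero_X₂ _ (isZero_zero _)) ((ShortComplex.exact_iff_mono _ rfl).2 ‹_›)
    hS (hF.of_isZero _ (isZero_zero _)) (hF.of_isZero _ (isZero_zero _)) h₂ h₃

theorem of_exact_epi (hF : IsCoNarrowFamily F) (n : ℤ) {S : ShortComplex A} (hS : S.Exact)
    [Epi S.g] (h₁ : F (n - 1) S.X₁) (h₂ : F n S.X₂) : F n S.X₃ :=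
  hF.of_exact n S.f S.g (0 : S.X₃ ⟶ 0) (0 : (0 : A) ⟶ 0) S.zero (by simp) (by simp)
    hS ((ShortComplex.exact_iff_epi _ rfl).2 ‹_›)
    (ShortComplex.exact_of_isZero_X₂ _ (isZero_zero _)) h₁ h₂ (hF.of_isZero _ (isZero_zero _))
    (hF.of_isZero _ (isZero_zero _))

theorem pred_le (hF : IsCoNarrowFamily F) (n : ℤ) : F (n - 1) ≤ F n := by
  simpa using hF.le_succ (n - 1)

theorem of_iso (hF : IsCoNarrowFamily F) {n : ℤ} {X Y : A} (e : X ≅ Y) (hX : F n X) : F n Y :=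
  let S := ShortComplex.mk e.inv (0 : X ⟶ 0) (by simp)
  have : Mono S.f := inferInstanceAs (Mono e.inv)
  have : Epi S.f := inferInstanceAs (Epi e.inv)
  hF.of_exact_mono n ((ShortComplex.exact_iff_epi S rfl).2 this) hX
    (hF.of_isZero _ (isZero_zero _))

theorem kernel_mem (hF : IsCoNarrowFamily F) {n n' : ℤ} (h : n + 1 = n') {X Y : A} (f : X ⟶ Y)
    (hX : F n X) (hY : F n' Y) : F n (kernel f) := by
  subst h
  exact hF.of_exact_mono n (ShortComplex.exact_kernel f) hX hY

theorem cokernel_mem (hF : IsCoNarrowFamily F) {n n' : ℤ} (h : n' + 1 = n) {X Y : A} (f : X ⟶ Y)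
    (hX : F n' X) (hY : F n Y) : F n (cokernel f) := by
  obtain rfl : n' = n - 1 := by lia
  exact hF.of_exact_epi n (ShortComplex.exact_cokernel f) hX hY

/-- A morphism from the reflection in `F n` to an object of `F (n + 1)` is determined by its
restriction. -/
theorem eq_zero_of_comp_reflection (hF : IsCoNarrowFamily F) {n n' : ℤ} (h : n + 1 = n')
    {X L : A} {η : X ⟶ L} (hL : F n L)
    (hη : ∀ W, F n W → Function.Bijective (fun g : L ⟶ W ↦ η ≫ g)) {W : A} (hW : F n' W)
    (g : L ⟶ W) (hg : η ≫ g = 0) : g = 0 := by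
  -- Since `kernel g` lies in `F n` and `η` factors through it, the universal property gives a
  -- section of `kernel.ι g`.
  have hK := hF.kernel_mem h g hL hW
  obtain ⟨v, hv : η ≫ v = _⟩ := (hη _ hK).2 (kernel.lift g η hg)
  have hv' : v ≫ kernel.ι g = 𝟙 L := (hη _ hL).1 (by
    change η ≫ v ≫ kernel.ι g = η ≫ 𝟙 L
    rw [reassoc_of% hv, kernel.lift_ι, Category.comp_id])
  rw [← Category.id_comp g, ← hv', Category.assoc, kernel.condition, comp_zero]

end IsCoNarrowFamily

namespace DerivedCategory.Bounded

variable {A : Type u} [Category.{v} A] [Abelian A] [HasDerivedCategory.{w} A]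

/-- The objects of `D^b A` whose `n`-th cohomology object lies in `F n` for all `n`. -/
def homologyIn (F : ℤ → ObjectProperty A) : ObjectProperty (Bounded A) :=
  fun X ↦ ∀ n, F n ((homology A n).obj X)

variable {F : ℤ → ObjectProperty A}

theorem homologyIn_isClosedUnderIsomorphisms (hF : IsCoNarrowFamily F) :
    (homologyIn F).IsClosedUnderIsomorphisms :=
  ⟨fun e hX n ↦ hF.of_iso ((homology A n).mapIso e) (hX n)⟩

theorem homologyIn_isTriangulatedClosed₂ (hF : IsCoNarrowFamily F) :
    (homologyIn F).IsTriangulatedClosed₂ :=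
  have := homologyIn_isClosedUnderIsomorphisms hF
  .mk' fun T hT h₁ h₃ n ↦ hF.of_exact n _ _ _ _ _ _ _
    (homology_exact₁ T hT (n - 1) n (by lia)) (homology_exact₂ T hT n)
    (homology_exact₃ T hT n (n + 1) rfl) (h₃ _) (h₁ _) (h₃ _) (h₁ _)

theorem homologyIn_shift (hF : IsCoNarrowFamily F) {X : Bounded A} (hX : homologyIn F X) :
    homologyIn F (X⟦(-1 : ℤ)⟧) := fun n ↦
  hF.of_iso (homologyShift X (-1) n (n - 1) (by lia)).symm (hF.pred_le n _ (hX _))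

theorem homologyIn_of_isZero (hF : IsCoNarrowFamily F) {X : Bounded A} (hX : IsZero X) :
    homologyIn F X := fun n ↦ hF.of_isZero n ((homology A n).map_isZero hX)

theorem homologyIn_single_iff (hF : IsCoNarrowFamily F) (n : ℤ) (W : A) :
    homologyIn F ((single A n).obj W) ↔ F n W := by
  refine ⟨fun h ↦ hF.of_iso (homologySingle n W) (h n), fun h m ↦ ?_⟩
  by_cases hm : m = n
  · subst hm
    exact hF.of_iso (homologySingle m W).symm h
  · exact hF.of_isZero _ (isZero_homology_single W hm)

theorem homologyIn_biprod (hF : IsCoNarrowFamily F) (X Y : Bounded A) (hX : homologyIn F X)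
    (hY : homologyIn F Y) : homologyIn F (X ⊞ Y) :=
  have := homologyIn_isTriangulatedClosed₂ hF
  have := homologyIn_isClosedUnderIsomorphisms hF
  (homologyIn F).ext_of_isTriangulatedClosed₂ _ (binaryBiproductTriangle_distinguished X Y) hX hY

theorem leftOrthogonal_homologyIn {N : Bounded A}
    (h : ∀ n W, F n W → ∀ f : N ⟶ (single A n).obj W, f = 0) :
    (homologyIn F).leftOrthogonal N :=
  fun X f hX ↦ hom_eq_zero_of_target X (fun n ↦ h n _ (hX n)) f

section

variable {n : ℤ} {X L : A} {η : X ⟶ L} {N : Bounded A} {i : N ⟶ (single A n).obj X}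
  {δ : (single A n).obj L ⟶ N⟦(1 : ℤ)⟧}

/-- Only the kernel of `η`, in degree `n`, and its cokernel, in degree `n + 1`, survive in the
cohomology of the fibre. -/
theorem isZero_homology_fibre (hT : Triangle.mk i ((single A n).map η) δ ∈ distTriang (Bounded A))
    {m : ℤ} (h₁ : m ≠ n) (h₂ : m ≠ n + 1) : IsZero ((homology A m).obj N) :=
  (homology_exact₁ _ hT (m - 1) m (by lia)).isZero_of_both_isZero
    (isZero_homology_single L (by lia)) (isZero_homology_single X h₁)

/-- Wakamatsu's lemma for the extension-closed subcategory of stalks of `F n` in degree `n`. -/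
theorem hom_fibre_eq_zero (hF : IsCoNarrowFamily F) (hL : F n L)
    (hη : ∀ W, F n W → Function.Bijective (fun g : L ⟶ W ↦ η ≫ g))
    (hT : Triangle.mk i ((single A n).map η) δ ∈ distTriang (Bounded A)) {W : A} (hW : F n W)
    (f : N ⟶ (single A n).obj W) : f = 0 := by
  let V : ObjectProperty (Bounded A) :=
    fun Y ↦ homologyIn F Y ∧ ∀ m, m ≠ n → IsZero ((homology A m).obj Y)
  have hiso := homologyIn_isClosedUnderIsomorphisms hF
  have hcl := homologyIn_isTriangulatedClosed₂ hF
  have : V.IsClosedUnderIsomorphisms := ⟨fun e hX ↦ ⟨hiso.of_iso e hX.1,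
    fun m hm ↦ (hX.2 m hm).of_iso ((homology A m).mapIso e.symm)⟩⟩
  have : V.IsTriangulatedClosed₂ := .mk' fun T hT h₁ h₃ ↦
    ⟨(homologyIn F).ext_of_isTriangulatedClosed₂ T hT h₁.1 h₃.1,
      fun m hm ↦ isZero_homology₂ T hT m (h₁.2 m hm) (h₃.2 m hm)⟩
  have hS (W : A) (hW : F n W) : V ((single A n).obj W) :=
    ⟨(homologyIn_single_iff hF n W).2 hW, fun m hm ↦ isZero_homology_single W hm⟩
  refine V.leftOrthogonal_of_bijective hT (hS L hL) (fun Y hY ↦ ?_) f (hS W hW)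
  obtain ⟨e⟩ := nonempty_iso_single Y n hY.2
  refine ⟨fun g g' hg ↦ ?_, fun g ↦ ?_⟩
  · obtain ⟨k, hk⟩ := (single A n).map_surjective (g ≫ e.hom)
    obtain ⟨k', hk'⟩ := (single A n).map_surjective (g' ≫ e.hom)
    rw [← cancel_mono e.hom, ← hk, ← hk']
    congr 1
    apply (hη _ (hY.1 n)).1
    apply (single A n).map_injective
    change (single A n).map (η ≫ k) = (single A n).map (η ≫ k')
    rw [Functor.map_comp, Functor.map_comp, hk, hk', ← Category.assoc, ← Category.assoc]
    exact congrArg (· ≫ e.hom) hg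
  · obtain ⟨k, hk⟩ := (single A n).map_surjective (g ≫ e.hom)
    obtain ⟨k', hk' : η ≫ k' = k⟩ := (hη _ (hY.1 n)).2 k
    refine ⟨(single A n).map k' ≫ e.inv, ?_⟩
    change (single A n).map η ≫ (single A n).map k' ≫ e.inv = g
    rw [← Functor.map_comp_assoc, hk', hk, Category.assoc, e.hom_inv_id, Category.comp_id]

/-- The obstruction to extending `f` along `i` is a map `L ⟶ W` killed by `η`, hence zero even
though `W` is only in `F (n + 1)`. The extension is then a map from degree `n` to degree `n + 1`,
which vanishes. -/
theorem hom_fibre_eq_zero_of_succ (hF : IsCoNarrowFamily F) (hL : F n L)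
    (hη : ∀ W, F n W → Function.Bijective (fun g : L ⟶ W ↦ η ≫ g))
    (hT : Triangle.mk i ((single A n).map η) δ ∈ distTriang (Bounded A)) {n' : ℤ}
    (h : n + 1 = n') {W : A} (hW : F n' W) (f : N ⟶ (single A n').obj W) : f = 0 := by
  let e := singleShift W 1 n' n (by lia)
  obtain ⟨g, hg⟩ := (single A n).map_surjective (δ ≫ f⟦(1 : ℤ)⟧' ≫ e.hom)
  have hηδ : (single A n).map η ≫ δ = 0 := comp_distTriang_mor_zero₂₃ _ hT
  have hg₀ : g = 0 := hF.eq_zero_of_comp_reflection h hL hη hW g (by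
    apply (single A n).map_injective
    rw [Functor.map_comp, hg, Functor.map_zero, reassoc_of% hηδ, zero_comp])
  have hδf : δ ≫ f⟦(1 : ℤ)⟧' = 0 := by
    rw [← cancel_mono e.hom, Category.assoc, ← hg, hg₀, Functor.map_zero, zero_comp]
  obtain ⟨k, rfl⟩ := exists_eq_mor₁_comp_of_distTriang hT f hδf
  rw [single_hom_eq_zero_of_lt (by lia) k, comp_zero]

theorem hom_fibre_eq_zero_of_ne (hA : IsHereditary A) (hF : IsCoNarrowFamily F) (hL : F n L)
    (hη : ∀ W, F n W → Function.Bijective (fun g : L ⟶ W ↦ η ≫ g))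
    (hT : Triangle.mk i ((single A n).map η) δ ∈ distTriang (Bounded A)) {m : ℤ}
    (hm : m + 1 ≠ n) {W : A} (hW : F m W) (f : N ⟶ (single A m).obj W) : f = 0 := by
  by_cases h₁ : m = n
  · subst h₁
    exact hom_fibre_eq_zero hF hL hη hT hW f
  by_cases h₂ : n + 1 = m
  · exact hom_fibre_eq_zero_of_succ hF hL hη hT h₂ hW f
  refine hom_eq_zero_of_source N (fun k g ↦ ?_) f
  by_cases hk : k = n ∨ k = n + 1
  · rcases lt_or_ge k m with h | h
    · exact single_hom_eq_zero_of_lt h g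
    · exact single_hom_eq_zero hA (by lia) g
  · exact ((single A k).map_isZero (isZero_homology_fibre hT (by lia) (by lia))).eq_of_src _ _

end

/-- The reflection of a projective object in `F n` has no extensions by objects of `F n`. -/
theorem hom_reflection_eq_zero_of_projective (hF : IsCoNarrowFamily F) {n : ℤ} {P L : A}
    [Projective P] {η : P ⟶ L} (hL : F n L)
    (hη : ∀ W, F n W → Function.Bijective (fun g : L ⟶ W ↦ η ≫ g)) {n' : ℤ} (h : n' + 1 = n)
    {W : A} (hW : F n W) (f : (single A n).obj L ⟶ (single A n').obj W) : f = 0 := by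
  obtain ⟨N, i, δ, hT⟩ := distinguished_cocone_triangle₁ ((single A n).map η)
  -- Restricted to `P`, the class `f` lies in an `Ext^1` out of a projective, so `f` factors through
  -- the shifted fibre.
  obtain ⟨g, rfl⟩ : ∃ g : N⟦(1 : ℤ)⟧ ⟶ _, f = δ ≫ g := Triangle.yoneda_exact₃ _ hT f
    (single_hom_eq_zero_of_projective (by lia) ((single A n).map η ≫ f))
  let e := singleShift W 1 n n' (by lia)
  obtain ⟨k, hk⟩ := (shiftFunctor (Bounded A) (1 : ℤ)).map_surjective (g ≫ e.inv)
  have hg : g = 0 := by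
    rw [← cancel_mono e.inv, ← hk, hom_fibre_eq_zero hF hL hη hT hW k, Functor.map_zero,
      zero_comp]
  rw [hg, comp_zero]

end DerivedCategory.Bounded

/-- The map `X₂ ⟶ L₂ ⟶ cokernel f` kills `X₁`, so it factors through `X₃` and vanishes. As `cokernel
f` lies in `F (a + 1)`, maps to it from `L₂` are detected on `X₂`. -/
theorem IsCoNarrowFamily.epi_of_reflection {A : Type u} [Category.{v} A] [Abelian A]
    {F : ℤ → ObjectProperty A} (hF : IsCoNarrowFamily F) {a n : ℤ} (h : a + 1 = n)
    {S : ShortComplex A} (hS : S.Exact) [Epi S.g]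
    (h₃ : ∀ W, F n W → ∀ g : S.X₃ ⟶ W, g = 0) {L₁ L₂ : A} (h₁ : F a L₁) (h₂ : F a L₂)
    {η₁ : S.X₁ ⟶ L₁} {η₂ : S.X₂ ⟶ L₂}
    (hη₂ : ∀ W, F a W → Function.Bijective (fun g : L₂ ⟶ W ↦ η₂ ≫ g)) (f : L₁ ⟶ L₂)
    (hf : η₁ ≫ f = S.f ≫ η₂) : Epi f := by
  have hc : F n (cokernel f) := hF.cokernel_mem h f h₁ (by subst h; exact hF.le_succ _ _ h₂)
  have hw : S.f ≫ η₂ ≫ cokernel.π f = 0 := by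
    rw [← Category.assoc, ← hf, Category.assoc, cokernel.condition, comp_zero]
  refine Preadditive.epi_of_cokernel_zero (hF.eq_zero_of_comp_reflection h h₂ hη₂ hc _ ?_)
  rw [← hS.g_desc _ hw, h₃ _ hc (hS.desc _ hw), comp_zero]

namespace DerivedCategory.Bounded

variable {A : Type u} [Category.{v} A] [Abelian A] [HasDerivedCategory.{w} A]
  {F : ℤ → ObjectProperty A}

theorem bijective_comp_of_single (hA : IsHereditary A) {X R : Bounded A} (ρ : X ⟶ R)
    (Y : Bounded A) (hY : ∀ n, Function.Bijective
      (fun g : R ⟶ (single A n).obj ((homology A n).obj Y) ↦ ρ ≫ g)) :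
    Function.Bijective (fun g : R ⟶ Y ↦ ρ ≫ g) := by
  let P : ObjectProperty (Bounded A) := fun Y ↦ Function.Bijective (fun g : R ⟶ Y ↦ ρ ≫ g)
  have : P.IsClosedUnderIsomorphisms := ⟨by
    refine fun {Y Z} e hY ↦ ⟨fun g g' hg ↦ ?_, fun f ↦ ?_⟩
    · have hg₁ : ρ ≫ g = ρ ≫ g' := hg
      rw [← cancel_mono e.inv]
      apply hY.1
      change ρ ≫ g ≫ e.inv = ρ ≫ g' ≫ e.inv
      rw [reassoc_of% hg₁]
    · obtain ⟨g, hg : ρ ≫ g = _⟩ := hY.2 (f ≫ e.inv)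
      exact ⟨g ≫ e.hom, by simp [reassoc_of% hg]⟩⟩
  refine biprod_induction hA P (fun Y hY ↦ ⟨fun _ _ _ ↦ hY.eq_of_tgt _ _,
    fun _ ↦ ⟨0, hY.eq_of_tgt _ _⟩⟩) (fun Y Z hY hZ ↦ ⟨fun g g' hg ↦ ?_, fun f ↦ ?_⟩) Y hY
  · have hg₁ : ρ ≫ g = ρ ≫ g' := hg
    apply biprod.hom_ext
    · apply hY.1
      change ρ ≫ g ≫ biprod.fst = ρ ≫ g' ≫ biprod.fst
      rw [reassoc_of% hg₁]
    · apply hZ.1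
      change ρ ≫ g ≫ biprod.snd = ρ ≫ g' ≫ biprod.snd
      rw [reassoc_of% hg₁]
  · obtain ⟨g, hg : ρ ≫ g = _⟩ := hY.2 (f ≫ biprod.fst)
    obtain ⟨g', hg' : ρ ≫ g' = _⟩ := hZ.2 (f ≫ biprod.snd)
    refine ⟨biprod.lift g g', ?_⟩
    change ρ ≫ biprod.lift g g' = f
    apply biprod.hom_ext
    · rw [Category.assoc, biprod.lift_fst, hg]
    · rw [Category.assoc, biprod.lift_snd, hg']

/-- The stalk of `J` in degree `n` is the fibre of a projective presentation `P₁ ⟶ P₀` in degree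
`a`. Its reflection is the fibre of the reflected map `f : L₁ ⟶ L₂`, which is the stalk of `kernel
f` because `f` is epi. For `W` in `F a`, both `Ext^1(J, W)` and `Hom(kernel f, W)` are the cokernel
of `Hom(L₂, W) ⟶ Hom(L₁, W)`, the latter because `Ext^1(L₂, W) = 0`. -/
theorem hasReflection_single_of_hom_eq_zero [EnoughProjectives A] (hA : IsHereditary A)
    (hF : IsCoNarrowFamily F) {a n : ℤ} (h : a + 1 = n) (hFa : ∀ X, (F a).HasReflection X)
    (J : A) (hJ : ∀ m, m ≠ a → ∀ W, F m W →
      ∀ f : (single A n).obj J ⟶ (single A m).obj W, f = 0) :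
    (homologyIn F).HasReflection ((single A n).obj J) := by
  let S : ShortComplex A := ShortComplex.mk (kernel.ι (Projective.π J)) (Projective.π J)
    (kernel.condition _)
  have hS : S.ShortExact :=
    { exact := ShortComplex.exact_kernel _
      mono_f := inferInstanceAs (Mono (kernel.ι _))
      epi_g := inferInstanceAs (Epi (Projective.π J)) }
  have := hS.epi_g
  have : Projective S.X₂ := inferInstanceAs (Projective (Projective.over J))
  have : Projective S.X₁ := projective_iff_hasProjectiveDimensionLT_one.2
    (hS.hasProjectiveDimensionLT_X₁ 1 inferInstance (hA J))
  obtain ⟨L₁, hL₁, η₁, hη₁⟩ := hFa S.X₁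
  obtain ⟨L₂, hL₂, η₂, hη₂⟩ := hFa S.X₂
  obtain ⟨f, hf : η₁ ≫ f = S.f ≫ η₂⟩ := (hη₁ _ hL₂).2 (S.f ≫ η₂)
  -- Uses `hJ` in degree `m = n`: there are no nonzero maps from `J` to `F n`.
  have hfepi : Epi f := hF.epi_of_reflection h hS.exact (fun W hW g ↦
    (single A n).map_injective ((hJ n (by lia) W hW _).trans (Functor.map_zero _ _ _).symm)) hL₁ hL₂ hη₂ f hf
  have hR : F a (kernel f) := hF.kernel_mem rfl f hL₁ (hF.le_succ _ _ hL₂)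
  obtain ⟨δ, hT⟩ := exists_distTriang_single (S := ShortComplex.mk _ _ (kernel.condition f))
    { exact := ShortComplex.exact_kernel f
      mono_f := inferInstanceAs (Mono (kernel.ι f))
      epi_g := hfepi } a
  obtain ⟨j, ε, hX⟩ : ∃ (j : ((single A a).obj J)⟦(-1 : ℤ)⟧ ⟶ (single A a).obj S.X₁)
      (ε : (single A a).obj S.X₂ ⟶ (((single A a).obj J)⟦(-1 : ℤ)⟧)⟦(1 : ℤ)⟧),
      Triangle.mk j ((single A a).map S.f) ε ∈ distTriang (Bounded A) := by
    obtain ⟨δ', hT'⟩ := exists_distTriang_single hS a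
    exact ⟨_, _, inv_rot_of_distTriang _ hT'⟩
  obtain ⟨ρ, hρ, -⟩ : ∃ ρ : ((single A a).obj J)⟦(-1 : ℤ)⟧ ⟶ (single A a).obj (kernel f),
      j ≫ (single A a).map η₁ = ρ ≫ (single A a).map (kernel.ι f) ∧ _ :=
    complete_distinguished_triangle_morphism₁ _ _ hX hT ((single A a).map η₁)
      ((single A a).map η₂) (by
        change (single A a).map S.f ≫ (single A a).map η₂ =
          (single A a).map η₁ ≫ (single A a).map f
        rw [← Functor.map_comp, ← Functor.map_comp, hf])
  let e := singleShift J (-1) a n (by lia)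
  -- Morphisms from the kernel extend to `L₁` when the obstruction vanishes.
  have ext {m : ℤ} {W : A} (g : (single A a).obj (kernel f) ⟶ (single A m).obj W)
      (hW : ∀ k : (single A a).obj L₂ ⟶ (single A (m - 1)).obj W, k = 0) :
      ∃ g', g = (single A a).map (kernel.ι f) ≫ g' := by
    let e' := singleShift W 1 m (m - 1) (by lia)
    refine exists_eq_mor₁_comp_of_distTriang hT g ?_
    rw [← cancel_mono e'.hom, zero_comp]
    exact hW _
  refine ObjectProperty.HasReflection.of_iso ⟨(single A a).obj (kernel f),
    (homologyIn_single_iff hF a _).2 hR, ρ, fun Y hY ↦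
    bijective_comp_of_single hA ρ Y fun m ↦ ?_⟩ e
  have hW := hY m
  generalize (homology A m).obj Y = W at hW
  by_cases hm : m = a
  · subst hm
    refine ⟨fun g g' hg ↦ sub_eq_zero.1 ?_, fun x ↦ ?_⟩
    · have hg₀ : ρ ≫ (g - g') = 0 := by
        rw [Preadditive.comp_sub]
        exact sub_eq_zero.2 hg
      -- The difference extends to `k : L₁ ⟶ W`. Since `η₁ ≫ k` factors through `P₀`, hence through
      -- `L₂`, `k` is a multiple of `f` and vanishes on `kernel f`.
      obtain ⟨k, hk⟩ := ext (g - g') fun k ↦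
        hom_reflection_eq_zero_of_projective hF hL₂ hη₂ (by lia) hW k
      obtain ⟨k, rfl⟩ := (single A m).map_surjective k
      obtain ⟨l, hl⟩ : ∃ l, (single A m).map η₁ ≫ (single A m).map k =
          (single A m).map S.f ≫ l := Triangle.yoneda_exact₂ _ hX _ (by
        change j ≫ (single A m).map η₁ ≫ (single A m).map k = 0
        rw [reassoc_of% hρ, ← hk, hg₀])
      obtain ⟨l, rfl⟩ := (single A m).map_surjective l
      obtain ⟨l', hl' : η₂ ≫ l' = l⟩ := (hη₂ _ hW).2 l
      have hkl : k = f ≫ l' := (hη₁ _ hW).1 ((single A m).map_injective (by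
        change (single A m).map (η₁ ≫ k) = (single A m).map (η₁ ≫ f ≫ l')
        rw [reassoc_of% hf, hl', Functor.map_comp, hl, Functor.map_comp]))
      rw [hk, ← Functor.map_comp, hkl, kernel.condition_assoc, zero_comp, Functor.map_zero]
    · let e' := singleShift W 1 m (m - 1) (by lia)
      -- Projectivity of `P₀` lets `x` extend to `P₁`, and the extension factors through `L₁`.
      obtain ⟨y, rfl⟩ := exists_eq_mor₁_comp_of_distTriang hX x (by
        rw [← cancel_mono e'.hom, zero_comp]
        exact single_hom_eq_zero_of_projective (by lia) _)
      obtain ⟨y, rfl⟩ := (single A m).map_surjective y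
      obtain ⟨y', rfl⟩ := (hη₁ _ hW).2 y
      refine ⟨(single A m).map (kernel.ι f) ≫ (single A m).map y', ?_⟩
      change ρ ≫ _ ≫ _ = j ≫ (single A m).map (η₁ ≫ y')
      rw [← reassoc_of% hρ, Functor.map_comp]
  · refine ⟨fun g g' _ ↦ ?_, fun x ↦ ⟨0, ?_⟩⟩
    · have h₀ (g : (single A a).obj (kernel f) ⟶ (single A m).obj W) : g = 0 := by
        rcases lt_or_ge a m with h | h
        · exact single_hom_eq_zero_of_lt h g
        by_cases h' : m + 1 = a
        · obtain ⟨g, rfl⟩ := ext g fun k ↦ single_hom_eq_zero hA (by lia) k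
          rw [hom_reflection_eq_zero_of_projective hF hL₁ hη₁ h'
            (by subst h'; exact hF.le_succ _ _ hW) g, comp_zero]
        · exact single_hom_eq_zero hA (by lia) g
      rw [h₀ g, h₀ g']
    · rw [← cancel_epi e.inv, hJ m hm W hW (e.inv ≫ x)]
      change e.inv ≫ ρ ≫ 0 = 0
      rw [comp_zero, comp_zero]

theorem hasReflection_homologyIn [EnoughProjectives A] (hA : IsHereditary A)
    (hF : IsCoNarrowFamily F) (hr : ∀ n X, (F n).HasReflection X) (X : Bounded A) :
    (homologyIn F).HasReflection X := by
  have hcl := homologyIn_isTriangulatedClosed₂ hF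
  have hiso := homologyIn_isClosedUnderIsomorphisms hF
  have h₀ : homologyIn F 0 := homologyIn_of_isZero hF (isZero_zero _)
  have ind (X : Bounded A) (hX : ∀ n, (homologyIn F).HasReflection
      ((single A n).obj ((homology A n).obj X))) : (homologyIn F).HasReflection X :=
    have : ObjectProperty.IsClosedUnderIsomorphisms (homologyIn F).HasReflection :=
      ⟨fun e h ↦ h.of_iso e⟩
    biprod_induction hA (homologyIn F).HasReflection
      (fun X hX ↦ .of_leftOrthogonal h₀ fun _ _ _ ↦ hX.eq_of_src _ _)
      (fun X Y ↦ .biprod (homologyIn_biprod hF)) X hX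
  refine ind X fun n ↦ ?_
  generalize (homology A n).obj X = B
  obtain ⟨L, hL, η, hη⟩ := hr n B
  obtain ⟨N, i, δ, hT⟩ := distinguished_cocone_triangle₁ ((single A n).map η)
  -- As `L` already lies in the subcategory, it is enough to decompose the fibre `N`, and for that
  -- to reflect each of its cohomology stalks.
  refine ObjectProperty.hasReflection_of_extensionProduct (V := homologyIn F) (fun _ ↦ homologyIn_shift hF)
    (ObjectProperty.extensionProduct_leftOrthogonal_of_distTriang _ _ hT
      (ObjectProperty.HasReflection.extensionProduct (ind N fun m ↦ ?_)) ((homologyIn_single_iff hF n L).2 hL))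
  obtain ⟨p, s, hsp, -⟩ := exists_retract_single hA N m
  have hN {k : ℤ} (hk : k + 1 ≠ n) {W : A} (hW : F k W)
      (f : (single A m).obj ((homology A m).obj N) ⟶ (single A k).obj W) : f = 0 := by
    rw [← Category.id_comp f, ← hsp, Category.assoc,
      hom_fibre_eq_zero_of_ne hA hF hL hη hT hk hW (p ≫ f), comp_zero]
  by_cases hm : m = n
  · subst hm
    exact hasReflection_single_of_hom_eq_zero hA hF (a := m - 1) (by lia) (hr _) _
      fun k hk W hW f ↦ hN (by lia) hW f
  by_cases hm' : m = n + 1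
  · refine .of_leftOrthogonal h₀ (leftOrthogonal_homologyIn fun k W hW f ↦ ?_)
    by_cases hk : k + 1 = n
    · exact single_hom_eq_zero hA (by lia) f
    · exact hN hk hW f
  · exact .of_leftOrthogonal h₀ fun _ _ _ ↦
      ((single A m).map_isZero (isZero_homology_fibre hT hm hm')).eq_of_src _ _

end DerivedCategory.Bounded

/-! ### The two constructions are mutually inverse. -/

theorem IsReflectiveCoNarrowSequence.isCoNarrowFamily {A : Type u} [Category.{v} A] [Abelian A]
    {C : ℤ → ObjectProperty A} (hC : IsReflectiveCoNarrowSequence C) :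
    IsCoNarrowFamily fun n ↦ C (-n) :=
  hC.coNarrow.isCoNarrowFamily fun k ↦
    let ⟨L, hL, _⟩ := (ObjectProperty.isRightAdjoint_ι_iff _).1 (hC.reflective k) 0
    ⟨L, hL⟩

section

open DerivedCategory.Bounded

variable {A : Type u} [Category.{v} A] [Abelian A] [HasDerivedCategory.{w} A]

/-- Each cohomology stalk of a member of `V` is a summand of it, so it is already in `V`. -/
theorem mu_eq_inverseImage_single (hA : IsHereditary A)
    {V : ObjectProperty (DerivedCategory.Bounded A)} (hV : V.IsCoaisle) (k : ℤ) :
    mu V k = V.inverseImage (single A (-k)) := by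
  have := hV.isClosedUnderIsomorphisms
  ext X
  constructor
  · rintro ⟨Y, hY, ⟨e⟩⟩
    exact V.prop_of_iso ((single A (-k)).mapIso e) (prop_single_homology hA hV hY (-k))
  · exact fun hX ↦ ⟨_, hX, ⟨homologySingle (-k) X⟩⟩

theorem isReflectiveCoNarrowSequence_mu (hA : IsHereditary A)
    {V : ObjectProperty (DerivedCategory.Bounded A)} (hV : V.IsCoaisle) :
    IsReflectiveCoNarrowSequence (mu V) where
  coNarrow := IsCoNarrowFamily.isCoNarrowSequence (by
    simpa only [mu_eq_inverseImage_single hA hV, neg_neg] using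
      isCoNarrowFamily_of_isCoaisle hA hV)
  reflective k := by
    rw [mu_eq_inverseImage_single hA hV]
    exact isRightAdjoint_ι_of_isCoaisle hA hV _

theorem theta_mu (hA : IsHereditary A) {V : ObjectProperty (DerivedCategory.Bounded A)}
    (hV : V.IsCoaisle) : theta (mu V) = V := by
  ext X
  refine ⟨fun hX ↦ prop_of_single_homology hA hV fun n ↦ ?_, fun hX k ↦ ⟨X, hX, ⟨Iso.refl _⟩⟩⟩
  have h := hX (-n)
  rw [mu_eq_inverseImage_single hA hV] at h
  obtain ⟨m, rfl⟩ : ∃ m, n = -m := ⟨-n, (neg_neg n).symm⟩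
  rw [neg_neg m] at h
  exact h

theorem theta_eq_homologyIn (C : ℤ → ObjectProperty A) :
    theta C = homologyIn (A := A) fun n ↦ C (-n) := by
  ext X
  refine ⟨fun h n ↦ ?_, fun h k ↦ ?_⟩
  · obtain ⟨m, rfl⟩ : ∃ m, n = -m := ⟨-n, (neg_neg n).symm⟩
    rw [neg_neg]
    exact h m
  · have hk : C (- -k) _ := h (-k)
    rw [neg_neg] at hk
    exact hk

namespace IsReflectiveCoNarrowSequence

variable {C : ℤ → ObjectProperty A} (hC : IsReflectiveCoNarrowSequence C)

include hC

theorem exists_tStructure [EnoughProjectives A] (hA : IsHereditary A) :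
    ∃ t : TStructure (DerivedCategory.Bounded A), t.ge 0 = theta C := by
  have hF := hC.isCoNarrowFamily
  have := homologyIn_isClosedUnderIsomorphisms (A := A) hF
  have := homologyIn_isTriangulatedClosed₂ (A := A) hF
  rw [theta_eq_homologyIn]
  exact ⟨_, ObjectProperty.tStructureOfCoaisle_ge_zero (homologyIn fun n ↦ C (-n))
    (fun _ ↦ homologyIn_shift hF) fun X ↦
    (hasReflection_homologyIn hA hF (fun n ↦ (ObjectProperty.isRightAdjoint_ι_iff _).1
      (hC.reflective (-n))) X).extensionProduct⟩

/-- Once `theta C` is known to be a coaisle, `mu` only sees its stalks, and a stalk has a single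
cohomology object to test. -/
theorem mu_theta [EnoughProjectives A] (hA : IsHereditary A) :
    mu (theta (A := A) C) = C := by
  obtain ⟨t, ht⟩ := hC.exists_tStructure hA
  have hV := t.isCoaisle_ge_zero
  rw [ht] at hV
  funext k
  rw [mu_eq_inverseImage_single hA hV]
  ext X
  rw [theta_eq_homologyIn, ObjectProperty.prop_inverseImage_iff,
    homologyIn_single_iff hC.isCoNarrowFamily, neg_neg]

end IsReflectiveCoNarrowSequence

end

end

theorem mainTheorem10 (A : Type u) [Category.{v} A] [Abelian A] [HasDerivedCategory.{w} A]
    [EnoughProjectives A] (hA : IsHereditary A) :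
    ∃ e : TStructure (DerivedCategory.Bounded A) ≃
        {C : ℤ → ObjectProperty A // IsReflectiveCoNarrowSequence C},
      (∀ t, (e t).1 = mu (t.ge 0)) ∧ (∀ C, (e.symm C).ge 0 = theta C.1) := by
  choose t ht using fun C : {C : ℤ → ObjectProperty A // IsReflectiveCoNarrowSequence C} ↦
    C.2.exists_tStructure (A := A) hA
  exact ⟨{ toFun := fun t ↦ ⟨mu (t.ge 0), isReflectiveCoNarrowSequence_mu hA t.isCoaisle_ge_zero⟩
           invFun := t
           left_inv := fun _ ↦ TStructure.ext_of_ge_zero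
             ((ht _).trans (theta_mu hA (TStructure.isCoaisle_ge_zero _)))
           right_inv := fun C ↦ Subtype.ext
             ((congrArg mu (ht C)).trans (C.2.mu_theta hA)) }, fun _ ↦ rfl, ht⟩
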